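/- Let $d\ge 1$. For a locally integrable $f$ on $\mathbb R^d$ of locally bounded variation (its distributional derivative $Df$ is a locally finite $\mathbb R^d$-valued Radon measure), let $|Df|$ be the variation measure of $Df$. Let $\mathrm{FP}$ be the set of all $A\subset\mathbb R^d$ (Lebesgue measurable, up to null sets) with $\mathbf 1_A\in L^1(\mathbb R^d)$ and $D\mathbf 1_A$ a finite measure, with the topology of strict convergence ($\mathbf 1_{A_i}\to\mathbf 1_A$ in $L^1$ and $|D\mathbf 1_{A_i}|(\mathbb R^d)\to|D\mathbf 1_A|(\mathbb R^d)$). Let $\mathrm{FP}_{\mathrm{loc}}$ be the set of all $A$ such that $\mathbf 1_A$ has locally bounded variation, with the topology of locally strict convergence ($\mathbf 1_{A_i}\to\mathbf 1_A$ in $L^1_{\mathrm{loc}}$ and $|D\mathbf 1_{A_i}|\to|D\mathbf 1_A|$ vaguely). Both carry their Borel $\sigma$-algebras. Let $\mathcal B_0$ be the family of those Borel sets $U\subset\mathrm{FP}$ for which there is a compact $K\subset\mathbb R^d$ with $|D\mathbf 1_A|(K)>0$ for all $A\in U$. Let $\mathcal N$ be the set of all Borel measures $\nu$ on $\mathrm{FP}$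 with values in $\{0,1,2,\dots\}\cup\{\infty\}$ that are finite on $\mathcal B_0$, with the smallest $\sigma$-algebra making all maps $\nu\mapsto\nu(U)$, $U\in\mathcal B_0$, measurable. An $\mathrm{FP}$-process is a measurable map $\Phi$ from a probability space $(\Omega,\Sigma,\Pr)$ to $\mathcal N$; write $A\in\Phi(\omega)$ if $\Phi(\omega)(\{A\})>0$. **Theorem.** Let $\Phi$ be an $\mathrm{FP}$-process. Then the union set $$X(\omega):=\bigcup_{A\in\Phi(\omega)}A$$ (well defined up to null sets) is a random set with locally finite perimeter: $X(\omega)\in\mathrm{FP}_{\mathrm{loc}}$ for every $\omega\in\Omega$, and $X:\Omega\to\mathrm{FP}_{\mathrm{loc}}$ is measurable. If $\Phi$ is stationary (for every $z\in\mathbb R^d$ its distribution is invariant under the map on $\mathcal N$ induced by $A\mapsto A+z$), then $X$ is stationary (for every $z\in\mathbb R^d$, $X$ and $X+z$ have the same distribution on $\mathrm{FP}_{\mathrm{loc}}$). -/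

import Mathlib

open MeasureTheory Set Topology
open scoped ENNReal

namespace FPProcess

/-! ### Functions of (locally) bounded variation on `ℝ^d` -/

/-- Euclidean `d`-space, with its Borel `σ`-algebra and Lebesgue measure `volume`. -/
abbrev Space (d : ℕ) : Type := EuclideanSpace ℝ (Fin d)

/-- The distributional derivative `Df` of `f` is the (locally finite) `ℝ^d`-valued Radon measure
`σ μ`, written in polar form: `μ` is a locally finite Borel measure on `ℝ^d`, `σ` is a Borel field
with `|σ| = 1` `μ`-almost everywhere, and `D_i f (φ) = - ∫ f ∂_i φ dx = ∫ φ σ_i dμ` for all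
`φ ∈ C^1_c(ℝ^d)` and all `i`. Every locally finite vector-valued Radon measure has exactly one such
form, and its variation measure is `μ`. -/
structure IsPolarDerivative {d : ℕ} (f : Space d → ℝ) (μ : Measure (Space d))
    (σ : Space d → Space d) : Prop where
  locallyFinite : IsLocallyFiniteMeasure μ
  measurable : Measurable σ
  norm_eq_one : ∀ᵐ x ∂μ, ‖σ x‖ = 1
  integral_eq : ∀ φ : Space d → ℝ, ContDiff ℝ 1 φ → HasCompactSupport φ → ∀ i : Fin d,
    -∫ x, f x * fderiv ℝ φ x (EuclideanSpace.single i 1) = ∫ x, φ x * σ x i ∂μ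

/-- `f` has locally bounded variation: `Df` is a locally finite vector-valued Radon measure. -/
def HasLocallyBoundedVariation {d : ℕ} (f : Space d → ℝ) : Prop :=
  ∃ μ σ, IsPolarDerivative f μ σ

/-- `f` has bounded variation: `Df` is a finite vector-valued Radon measure. -/
def HasBoundedVariation {d : ℕ} (f : Space d → ℝ) : Prop :=
  ∃ μ σ, IsPolarDerivative f μ σ ∧ μ univ < ∞

/-- The variation measure `|Df|` of a function `f` of locally bounded variation: the measure `μ` of
the polar form `Df = σ μ`. (For such `f` the set below consists of exactly one measure, and `sInf`
picks it out.) -/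
noncomputable def variationMeasure {d : ℕ} (f : Space d → ℝ) : Measure (Space d) :=
  sInf {μ | ∃ σ, IsPolarDerivative f μ σ}

/-- The class `f` is the indicator function of a Lebesgue measurable subset of `ℝ^d`. -/
def IsIndicator {d : ℕ} (f : Space d → ℝ) : Prop :=
  ∃ A : Set (Space d), NullMeasurableSet A volume ∧ f =ᵐ[volume] A.indicator 1

/-! ### The spaces `BV`, `FP` with strict convergence -/

/-- `BV`: the elements of `L^1(ℝ^d)` of bounded variation. -/
structure BV (d : ℕ) : Type where
  toLp : Lp ℝ 1 (volume : Measure (Space d))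
  hasBoundedVariation : HasBoundedVariation (toLp : Space d → ℝ)

/-- The variation `Vf = |Df|(ℝ^d)`. -/
noncomputable def BV.variation {d : ℕ} (f : BV d) : ℝ :=
  (variationMeasure (f.toLp : Space d → ℝ) univ).toReal

/-- The topology of strict convergence: `f_i → f` iff `f_i → f` in `L^1` and `V f_i → V f`. -/
noncomputable instance (d : ℕ) : TopologicalSpace (BV d) :=
  TopologicalSpace.induced (fun f : BV d => (f.toLp, f.variation)) inferInstance

/-- `FP ⊂ BV`: sets of finite perimeter (modulo null sets). As `FP ⊂ L^1`, these sets have finite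
volume. -/
structure FP (d : ℕ) : Type where
  toBV : BV d
  isIndicator : IsIndicator (toBV.toLp : Space d → ℝ)

/-- `FP` carries the subspace topology of `BV`. -/
noncomputable instance (d : ℕ) : TopologicalSpace (FP d) :=
  TopologicalSpace.induced FP.toBV inferInstance

/-- `FP` carries its Borel `σ`-algebra. -/
noncomputable instance (d : ℕ) : MeasurableSpace (FP d) := borel (FP d)

instance (d : ℕ) : BorelSpace (FP d) := ⟨rfl⟩

/-- The indicator function `1_A` of `A ∈ FP`. -/
noncomputable def FP.ind {d : ℕ} (A : FP d) : Space d → ℝ := A.toBV.toLp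

/-! ### The spaces `BV_loc`, `FP_loc` with locally strict convergence -/

/-- `BV_loc`: classes of locally integrable functions of locally bounded variation. -/
structure BVloc (d : ℕ) : Type where
  toAEEqFun : Space d →ₘ[volume] ℝ
  locallyIntegrable : LocallyIntegrable (toAEEqFun : Space d → ℝ) volume
  hasLocallyBoundedVariation : HasLocallyBoundedVariation (toAEEqFun : Space d → ℝ)

/-- The restriction of `f` to the compact set `K`, as an element of `L^1(K)`. -/
noncomputable def BVloc.restrict {d : ℕ} (K : TopologicalSpace.Compacts (Space d)) (f : BVloc d) :
    Lp ℝ 1 (volume.restrict (K : Set (Space d))) :=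
  Integrable.toL1 (f.toAEEqFun : Space d → ℝ)
    (f.locallyIntegrable.integrableOn_isCompact K.isCompact)

/-- The topology of locally strict convergence: `f_i → f` iff `f_i → f` in `L^1(K)` for all compact
`K` and `|Df_i| → |Df|` vaguely, i.e. `∫ g d|Df_i| → ∫ g d|Df|` for all `g ∈ C_c(ℝ^d)`. -/
noncomputable instance (d : ℕ) : TopologicalSpace (BVloc d) :=
  (⨅ K : TopologicalSpace.Compacts (Space d),
    TopologicalSpace.induced (BVloc.restrict K) inferInstance) ⊓
  (⨅ g : CompactlySupportedContinuousMap (Space d) ℝ,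
    TopologicalSpace.induced
      (fun f : BVloc d => ∫ x, g x ∂(variationMeasure (f.toAEEqFun : Space d → ℝ)))
      inferInstance)

/-- `FP_loc ⊂ BV_loc`: sets of locally finite perimeter (modulo null sets). -/
structure FPloc (d : ℕ) : Type where
  toBVloc : BVloc d
  isIndicator : IsIndicator (toBVloc.toAEEqFun : Space d → ℝ)

/-- `FP_loc` carries the subspace topology of `BV_loc`. -/
noncomputable instance (d : ℕ) : TopologicalSpace (FPloc d) :=
  TopologicalSpace.induced FPloc.toBVloc inferInstance

/-- `FP_loc` carries its Borel `σ`-algebra. -/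
noncomputable instance (d : ℕ) : MeasurableSpace (FPloc d) := borel (FPloc d)

instance (d : ℕ) : BorelSpace (FPloc d) := ⟨rfl⟩

/-- The indicator function `1_A` of `A ∈ FP_loc`. -/
noncomputable def FPloc.ind {d : ℕ} (A : FPloc d) : Space d → ℝ := A.toBVloc.toAEEqFun

/-! ### Translations -/

theorem measurePreserving_sub {d : ℕ} (z : Space d) :
    MeasurePreserving (fun x : Space d => x - z) volume volume :=
  measurePreserving_sub_right volume z

theorem IsPolarDerivative.congr {d : ℕ} {f g : Space d → ℝ} {μ : Measure (Space d)}
    {σ : Space d → Space d} (h : IsPolarDerivative f μ σ) (hfg : f =ᵐ[volume] g) :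
    IsPolarDerivative g μ σ where
  locallyFinite := h.locallyFinite
  measurable := h.measurable
  norm_eq_one := h.norm_eq_one
  integral_eq φ h1 h2 i := by
    rw [← h.integral_eq φ h1 h2 i]
    congr 1
    refine integral_congr_ae ?_
    filter_upwards [hfg] with x hx
    rw [hx]

theorem IsPolarDerivative.translate {d : ℕ} {f : Space d → ℝ} {μ : Measure (Space d)}
    {σ : Space d → Space d} (h : IsPolarDerivative f μ σ) (z : Space d) :
    IsPolarDerivative (fun x => f (x - z)) (μ.map (fun x => x + z)) (fun x => σ (x - z)) where
  locallyFinite := by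
    have := h.locallyFinite
    refine ⟨fun x => ?_⟩
    obtain ⟨s, hs, hμ⟩ := μ.finiteAt_nhds (x - z)
    have he : MeasurableEmbedding (fun x : Space d => x + z) := measurableEmbedding_addRight z
    refine ⟨(fun y => y - z) ⁻¹' s,
      (continuous_id.sub continuous_const).continuousAt.preimage_mem_nhds hs, ?_⟩
    rw [he.map_apply]
    simpa [preimage_preimage] using hμ
  measurable := h.measurable.comp (measurable_id.sub_const z)
  norm_eq_one := by
    have he : MeasurableEmbedding (fun x : Space d => x + z) := measurableEmbedding_addRight z
    rw [he.ae_map_iff]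
    simpa using h.norm_eq_one
  integral_eq φ h1 h2 i := by
    have he : MeasurableEmbedding (fun x : Space d => x + z) := measurableEmbedding_addRight z
    rw [he.integral_map]
    have h3 := h.integral_eq (fun x => φ (x + z)) (h1.comp (contDiff_id.add contDiff_const))
      (h2.comp_homeomorph (Homeomorph.addRight z)) i
    simp only [add_sub_cancel_right]
    rw [← h3, ← integral_add_right_eq_self _ z]
    simp only [add_sub_cancel_right, fderiv_comp_add_right]

theorem variationMeasure_congr {d : ℕ} {f g : Space d → ℝ} (hfg : f =ᵐ[volume] g) :
    variationMeasure f = variationMeasure g := by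
  unfold variationMeasure
  congr 1
  ext μ
  exact ⟨fun ⟨σ, h⟩ => ⟨σ, h.congr hfg⟩, fun ⟨σ, h⟩ => ⟨σ, h.congr hfg.symm⟩⟩

theorem le_variationMeasure_translate {d : ℕ} (f : Space d → ℝ) (z : Space d) :
    (variationMeasure f).map (fun x => x + z) ≤ variationMeasure (fun x => f (x - z)) := by
  refine le_sInf ?_
  rintro μ ⟨σ, hσ⟩
  have h1 := hσ.translate (-z)
  have h2 : variationMeasure f ≤ μ.map (fun x => x + -z) := by
    refine sInf_le ⟨fun x => σ (x - -z), ?_⟩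
    simpa using h1
  calc (variationMeasure f).map (fun x => x + z)
      ≤ (μ.map (fun x => x + -z)).map (fun x => x + z) :=
        Measure.map_mono h2 (measurable_add_const z)
    _ = μ := by
      rw [Measure.map_map (measurable_add_const z) (measurable_add_const (-z))]
      have : (fun x : Space d => x + z) ∘ (fun x => x + -z) = id := by ext x; simp
      rw [this, Measure.map_id]

theorem variationMeasure_translate {d : ℕ} (f : Space d → ℝ) (z : Space d) :
    variationMeasure (fun x => f (x - z)) = (variationMeasure f).map (fun x => x + z) := by
  refine le_antisymm ?_ (le_variationMeasure_translate f z)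
  have h := le_variationMeasure_translate (fun x => f (x - z)) (-z)
  have h' := Measure.map_mono h (measurable_add_const z : Measurable fun x : Space d => x + z)
  rw [Measure.map_map (measurable_add_const z) (measurable_add_const (-z))] at h'
  have h1 : (fun x : Space d => x + z) ∘ (fun x => x + -z) = id := by ext x; simp
  have h2 : (fun x : Space d => f (x - -z - z)) = f := by ext x; simp
  rwa [h1, Measure.map_id, h2] at h'

theorem IsIndicator.translate {d : ℕ} {f : Space d → ℝ} (h : IsIndicator f) (z : Space d) :
    IsIndicator (fun x => f (x - z)) := by
  obtain ⟨A, hA, hfA⟩ := h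
  refine ⟨(fun x => x - z) ⁻¹' A,
    hA.preimage (measurePreserving_sub z).quasiMeasurePreserving, ?_⟩
  exact (measurePreserving_sub z).quasiMeasurePreserving.ae_eq_comp hfA

theorem IsIndicator.congr {d : ℕ} {f g : Space d → ℝ} (h : IsIndicator f)
    (hfg : f =ᵐ[volume] g) : IsIndicator g := by
  obtain ⟨A, hA, hfA⟩ := h
  exact ⟨A, hA, hfg.symm.trans hfA⟩

/-- The translate `x ↦ f(x - z)` of `f ∈ BV`. -/
noncomputable def BV.translate {d : ℕ} (z : Space d) (f : BV d) : BV d where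
  toLp := Lp.compMeasurePreserving (fun x => x - z) (measurePreserving_sub z) f.toLp
  hasBoundedVariation := by
    obtain ⟨μ, σ, h, hμ⟩ := f.hasBoundedVariation
    refine ⟨_, _, (h.translate z).congr
      (Lp.coeFn_compMeasurePreserving f.toLp (measurePreserving_sub z)).symm, ?_⟩
    rwa [Measure.map_apply (measurable_add_const z) MeasurableSet.univ]

theorem BV.variationMeasure_translate {d : ℕ} (z : Space d) (f : BV d) :
    variationMeasure ((f.translate z).toLp : Space d → ℝ) =
      (variationMeasure (f.toLp : Space d → ℝ)).map (fun x => x + z) := by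
  rw [← FPProcess.variationMeasure_translate]
  exact variationMeasure_congr (Lp.coeFn_compMeasurePreserving f.toLp (measurePreserving_sub z))

theorem BV.variation_translate {d : ℕ} (z : Space d) (f : BV d) :
    (f.translate z).variation = f.variation := by
  unfold BV.variation
  rw [BV.variationMeasure_translate,
    Measure.map_apply (measurable_add_const z) MeasurableSet.univ, preimage_univ]

theorem BV.continuous_translate {d : ℕ} (z : Space d) :
    Continuous (BV.translate z : BV d → BV d) := by
  have hc : Continuous (fun f : BV d => (f.toLp, f.variation)) := continuous_induced_dom
  refine continuous_induced_rng.2 (Continuous.prodMk ?_ ?_)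
  · exact (Lp.isometry_compMeasurePreserving (measurePreserving_sub z)).continuous.comp
      (continuous_fst.comp hc)
  · simp only [BV.variation_translate]
    exact continuous_snd.comp hc

/-- The translate `A + z` of `A ∈ FP`. -/
noncomputable def FP.translate {d : ℕ} (z : Space d) (A : FP d) : FP d where
  toBV := A.toBV.translate z
  isIndicator := (A.isIndicator.translate z).congr
    (Lp.coeFn_compMeasurePreserving A.toBV.toLp (measurePreserving_sub z)).symm

theorem FP.measurable_translate {d : ℕ} (z : Space d) :
    Measurable (FP.translate z : FP d → FP d) := by
  refine Continuous.measurable (continuous_induced_rng.2 ?_)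
  exact (BV.continuous_translate z).comp continuous_induced_dom

/-- The translate `x ↦ f(x - z)` of `f ∈ BV_loc`. -/
noncomputable def BVloc.translate {d : ℕ} (z : Space d) (f : BVloc d) : BVloc d where
  toAEEqFun := f.toAEEqFun.compMeasurePreserving (fun x => x - z) (measurePreserving_sub z)
  locallyIntegrable := by
    refine LocallyIntegrable.congr ?_
      (AEEqFun.coeFn_compMeasurePreserving f.toAEEqFun (measurePreserving_sub z)).symm
    intro x
    obtain ⟨s, hs, hi⟩ := f.locallyIntegrable (x - z)
    refine ⟨(fun y => y - z) ⁻¹' s,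
      (continuous_id.sub continuous_const).continuousAt.preimage_mem_nhds hs, ?_⟩
    have he : MeasurableEmbedding (fun x : Space d => x - z) := by
      simpa [sub_eq_add_neg] using
        (measurableEmbedding_addRight (-z) : MeasurableEmbedding fun x : Space d => x + -z)
    exact ((measurePreserving_sub z).integrableOn_comp_preimage he).2 hi
  hasLocallyBoundedVariation := by
    obtain ⟨μ, σ, h⟩ := f.hasLocallyBoundedVariation
    exact ⟨_, _, (h.translate z).congr
      (AEEqFun.coeFn_compMeasurePreserving f.toAEEqFun (measurePreserving_sub z)).symm⟩

/-- The translate `A + z` of `A ∈ FP_loc`. -/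
noncomputable def FPloc.translate {d : ℕ} (z : Space d) (A : FPloc d) : FPloc d where
  toBVloc := A.toBVloc.translate z
  isIndicator := (A.isIndicator.translate z).congr
    (AEEqFun.coeFn_compMeasurePreserving A.toBVloc.toAEEqFun (measurePreserving_sub z)).symm

/-! ### Point processes on `FP` -/

/-- The family `𝓑₀` of bounded sets: the Borel sets `U ⊂ FP` such that for some compact `K ⊂ ℝ^d`
one has `|D1_A|(K) > 0` for all `A ∈ U`. -/
def IsBoundedFamily {d : ℕ} (U : Set (FP d)) : Prop :=
  MeasurableSet U ∧ ∃ K : Set (Space d), IsCompact K ∧ ∀ A ∈ U, 0 < variationMeasure A.ind K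

/-- The set `𝓝^#_FP` of all integer-valued (nonnegative) Borel measures on `FP` which are finite on
`𝓑₀`. (On sets outside `𝓑₀`, the value `∞` is allowed.) -/
structure Config (d : ℕ) : Type where
  toMeasure : Measure (FP d)
  integer_valued : ∀ U, MeasurableSet U → ∃ n : ℕ∞, toMeasure U = (n : ℝ≥0∞)
  finite_on_bounded : ∀ U, IsBoundedFamily U → toMeasure U < ∞

/-- The `σ`-algebra on `𝓝^#_FP` generated by the maps `ν ↦ ν(U)`, `U ∈ 𝓑₀`. -/
noncomputable instance (d : ℕ) : MeasurableSpace (Config d) :=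
  ⨆ U : {U : Set (FP d) // IsBoundedFamily U},
    MeasurableSpace.comap (fun ν : Config d => ν.toMeasure U.1) inferInstance

theorem IsBoundedFamily.preimage_translate {d : ℕ} {U : Set (FP d)} (h : IsBoundedFamily U)
    (z : Space d) : IsBoundedFamily (FP.translate z ⁻¹' U) := by
  obtain ⟨hU, K, hK, hpos⟩ := h
  refine ⟨FP.measurable_translate z hU, (Homeomorph.addRight z) ⁻¹' K,
    (Homeomorph.addRight z).isClosedEmbedding.isCompact_preimage hK, fun A hA => ?_⟩
  have h1 := hpos _ hA
  have h2 : variationMeasure (A.translate z).ind =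
    (variationMeasure A.ind).map (fun x => x + z) := BV.variationMeasure_translate z A.toBV
  rwa [h2, Measure.map_apply (measurable_add_const z) hK.measurableSet] at h1

/-- The shift of a configuration by `z`: the image of `ν` under `A ↦ A + z`. -/
noncomputable def Config.shift {d : ℕ} (z : Space d) (ν : Config d) : Config d where
  toMeasure := ν.toMeasure.map (FP.translate z)
  integer_valued U hU := by
    rw [Measure.map_apply (FP.measurable_translate z) hU]
    exact ν.integer_valued _ (FP.measurable_translate z hU)
  finite_on_bounded U hU := by
    rw [Measure.map_apply (FP.measurable_translate z) hU.1]
    exact ν.finite_on_bounded _ (hU.preimage_translate z)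

/-- `X = ⋃_{A ∈ ν} A` up to a null set, where `A ∈ ν` means `ν({A}) > 0`. The particles and `X` are
sets modulo null sets; the equality is required for every choice `r` of representatives of the
particles. -/
def IsUnionOf {d : ℕ} (X : FPloc d) (ν : Config d) : Prop :=
  ∀ r : FP d → Set (Space d), (∀ A, A.ind =ᵐ[volume] (r A).indicator 1) →
    X.ind =ᵐ[volume] (⋃ A ∈ {A : FP d | 0 < ν.toMeasure {A}}, r A).indicator 1

/-- The process `Φ` is stationary: its distribution is invariant under the shifts. -/
def IsStationaryProcess {d : ℕ} {Ω : Type*} [MeasurableSpace Ω] (P : Measure Ω)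
    (Φ : Ω → Config d) : Prop :=
  ∀ z : Space d, P.map (fun ω => (Φ ω).shift z) = P.map Φ

/-- The random set `X` is stationary: its distribution is translation invariant. -/
def IsStationarySet {d : ℕ} {Ω : Type*} [MeasurableSpace Ω] (P : Measure Ω)
    (X : Ω → FPloc d) : Prop :=
  ∀ z : Space d, P.map (fun ω => (X ω).translate z) = P.map X

end FPProcess

namespace FPProcess

/-! Two facts are needed: the union of a configuration has locally finite perimeter, and it depends
measurably on the configuration. The union commutes with translations, so stationarity is then
inherited.

Everything rests on a duality. For continuous `g ≥ 0` of compact support, `∫ g d|Df|` is the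
supremum of the pairings of `Df` with `C^1` fields of compact support dominated by `g`
(`IsPolarDerivative.ofReal_integral_eq_iSup`). Hence `|Df|` is determined by `f`, and `∫ g d|Df|` is
lower semicontinuous in `f` for `L^1` convergence on a neighbourhood of the support of `g`.

Perimeter of the union: a bound `μ` on a directional derivative (`DerivLE`) gives weighted `L^1`
bounds on the differences `f(x + se) - f(x)`, and letting `s → 0` recovers the derivative bound. For
indicators these differences are subadditive under unions, so the bounds add up (`DerivLE.iUnion`).
An integer-valued measure has finitely many atoms in a set of finite mass, so only finitely many
particles have perimeter in a given ball and the sum of the perimeter measures is locally finite. A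
Riesz argument turns this scalar bound back into a vector-valued derivative
(`hasLocallyBoundedVariation_of_derivLE`).

Measurability: the restrictions to balls in `L^1`, together with the integrals of countably many
tent functions against `|Df|`, control the locally strict topology (`BVloc.continuous_of_tent`). By
lower semicontinuity these integrals are Borel functions of the restrictions, so only the
restrictions need attention. In `L^1` of a ball the union is a limit of finite lattice suprema of
indicators. Replacing each particle by the value of a simple function, one only has to know which
values occur among the particles. This is read off from the masses of bounded families, because an
integer-valued measure has an atom in every set of positive finite mass
(`exists_mem_measure_singleton_pos`). -/

/-! ### Approximation of unit fields by `C^1` fields. -/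

/-- Radial projection onto the unit ball moves `t` by `max (‖t‖ - 1) 0`, which is at most the
distance of `t` to any unit vector. The approximants of a unit field can thus be kept in the unit
ball at the cost of a factor 2. -/
theorem norm_smul_inv_max_sub_le {F : Type*} [NormedAddCommGroup F] [NormedSpace ℝ F] (t s : F)
    (hs : ‖s‖ = 1) : ‖s - (max 1 ‖t‖)⁻¹ • t‖ ≤ 2 * ‖s - t‖ := by
  have h1 : ‖t - (max 1 ‖t‖)⁻¹ • t‖ ≤ ‖s - t‖ := by
    have hm : 0 < max 1 ‖t‖ := by positivity
    have e : t - (max 1 ‖t‖)⁻¹ • t = (1 - (max 1 ‖t‖)⁻¹) • t := by rw [sub_smul, one_smul]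
    rw [e, norm_smul]
    rcases le_total ‖t‖ 1 with h | h
    · simp [max_eq_left h]
    · rw [max_eq_right h, Real.norm_eq_abs, abs_of_nonneg]
      · rw [sub_mul, inv_mul_cancel₀ (by linarith), one_mul, ← hs, norm_sub_rev]
        exact norm_sub_norm_le _ _
      · rw [sub_nonneg]
        exact inv_le_one_of_one_le₀ h
  calc ‖s - (max 1 ‖t‖)⁻¹ • t‖ = ‖(s - t) + (t - (max 1 ‖t‖)⁻¹ • t)‖ := by congr 1; abel
    _ ≤ ‖s - t‖ + ‖t - (max 1 ‖t‖)⁻¹ • t‖ := norm_add_le _ _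
    _ ≤ 2 * ‖s - t‖ := by linarith

theorem norm_inv_max_smul_le {F : Type*} [NormedAddCommGroup F] [NormedSpace ℝ F] (t : F) :
    ‖(max 1 ‖t‖)⁻¹ • t‖ ≤ 1 := by
  have hm : 0 < max 1 ‖t‖ := by positivity
  rw [norm_smul, norm_inv, Real.norm_of_nonneg hm.le, inv_mul_le_iff₀ hm, mul_one]
  exact le_max_right _ _

/-- A unit field is tested up to `ε` by `C^1` fields dominated by a continuous function. -/
theorem exists_contDiff_integral_inner_ge {d : ℕ} {F : Type*} [NormedAddCommGroup F]
    [InnerProductSpace ℝ F] {μ : Measure (Space d)} [IsLocallyFiniteMeasure μ]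
    {σ : Space d → F} (hσ : AEStronglyMeasurable σ μ) (h1 : ∀ᵐ x ∂μ, ‖σ x‖ = 1)
    {g : Space d → ℝ} (hg : Continuous g) (hgs : HasCompactSupport g) (g0 : ∀ x, 0 ≤ g x)
    {ε : ℝ} (hε : 0 < ε) :
    ∃ φ : Space d → F, ContDiff ℝ 1 φ ∧ HasCompactSupport φ ∧ (∀ x, ‖φ x‖ ≤ g x) ∧
      ∫ x, g x ∂μ - ε ≤ ∫ x, inner ℝ (φ x) (σ x) ∂μ := by
  set K := tsupport g with hK
  have hKc : IsCompact K := hgs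
  have hKm : MeasurableSet K := hKc.measurableSet
  have hKf : μ K < ∞ := hKc.measure_lt_top
  obtain ⟨M, hM⟩ := hg.bounded_above_of_compact_support hgs
  have hM0 : 0 ≤ M := (norm_nonneg _).trans (hM 0)
  have : IsFiniteMeasure (μ.restrict K) := ⟨by simpa using hKf⟩
  have hσi : Integrable σ (μ.restrict K) := by
    refine Integrable.of_bound hσ.restrict 1 ?_
    filter_upwards [ae_restrict_of_ae h1] with x hx using hx.le
  set m := (μ K).toReal with hm
  have hm0 : 0 ≤ m := ENNReal.toReal_nonneg
  -- The final error is `2δ μ(K) + 2Mδ`; the summand 1 keeps the denominator positive.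
  set δ := ε / (2 * m + 2 * M + 1) with hδ
  have hδ0 : 0 < δ := by positivity
  have hδε : δ * (2 * m + 2 * M) ≤ ε := by
    have : δ * (2 * m + 2 * M + 1) = ε := by rw [hδ]; field_simp
    nlinarith
  obtain ⟨τ, -, hτ, hτc, hτi⟩ := hσi.exists_hasCompactSupport_integral_sub_le hδ0
  set τ' : Space d → F := fun x => (max 1 ‖τ x‖)⁻¹ • τ x with hτ'
  have hτ'c : Continuous τ' := by
    refine Continuous.smul (Continuous.inv₀ (continuous_const.max hτc.norm) fun x => ?_) hτc
    positivity
  -- Lowering `g` by `δ` leaves room for the `C^1` approximation: it is `δ`-close to `φ₀` and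
  -- supported where `φ₀` is nonzero, hence still dominated by `g`.
  set φ₀ : Space d → F := fun x => max (g x - δ) 0 • τ' x with hφ₀
  have hφ₀c : Continuous φ₀ := ((hg.sub continuous_const).max continuous_const).smul hτ'c
  obtain ⟨φ, hφ, hφd, hφs⟩ := hφ₀c.exists_contDiff_approx 1 (continuous_const (y := δ))
    fun _ => hδ0
  have hφg : ∀ x, ‖φ x‖ ≤ g x := by
    intro x
    by_cases hx : x ∈ Function.support φ
    · have h2 : φ₀ x ≠ 0 := hφs hx
      have h3 : 0 < g x - δ := by
        by_contra h
        apply h2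
        simp [hφ₀, max_eq_right (not_lt.1 h)]
      have h4 : ‖φ₀ x‖ ≤ g x - δ := by
        rw [hφ₀]
        simp only
        rw [norm_smul, max_eq_left h3.le, Real.norm_of_nonneg h3.le]
        exact mul_le_of_le_one_right h3.le (norm_inv_max_smul_le _)
      have h5 := hφd x
      rw [dist_eq_norm] at h5
      have h6 : ‖φ x‖ ≤ ‖φ₀ x‖ + ‖φ x - φ₀ x‖ := by
        simpa using norm_add_le (φ₀ x) (φ x - φ₀ x)
      linarith
    · rw [Function.notMem_support.1 hx, norm_zero]
      exact g0 x
  have hφcs : HasCompactSupport φ := by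
    refine hgs.mono fun x hx => ?_
    intro h
    exact hx (norm_le_zero_iff.1 ((hφg x).trans h.le))
  refine ⟨φ, hφ, hφcs, hφg, ?_⟩
  have hoff : ∀ x, x ∉ K → g x = 0 := fun x hx => image_eq_zero_of_notMem_tsupport hx
  have hφoff : ∀ x, x ∉ K → φ x = 0 := fun x hx =>
    norm_le_zero_iff.1 ((hφg x).trans (hoff x hx).le)
  have e1 : ∫ x, g x ∂μ = ∫ x in K, g x ∂μ :=
    (setIntegral_eq_integral_of_forall_compl_eq_zero fun x hx => hoff x hx).symm
  have e2 : ∫ x, inner ℝ (φ x) (σ x) ∂μ = ∫ x in K, inner ℝ (φ x) (σ x) ∂μ :=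
    (setIntegral_eq_integral_of_forall_compl_eq_zero fun x hx => by simp [hφoff x hx]).symm
  have i1 : Integrable g (μ.restrict K) := (hg.integrable_of_hasCompactSupport hgs).restrict
  have i2 : Integrable (fun x => (inner ℝ (φ x) (σ x) : ℝ)) (μ.restrict K) := by
    refine Integrable.of_bound (hφ.continuous.aestronglyMeasurable.inner hσ.restrict) M ?_
    filter_upwards [ae_restrict_of_ae h1] with x hx
    refine (norm_inner_le_norm _ _).trans ?_
    rw [hx, mul_one]
    exact (hφg x).trans ((le_abs_self _).trans (hM x))
  have i3 : Integrable (fun x => ‖σ x - τ x‖) (μ.restrict K) := (hσi.sub hτi).norm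
  rw [e1, e2, sub_le_comm, ← integral_sub i1 i2]
  calc ∫ x in K, (g x - inner ℝ (φ x) (σ x)) ∂μ
      ≤ ∫ x in K, (2 * δ + 2 * M * ‖σ x - τ x‖) ∂μ := by
        refine integral_mono_ae (i1.sub i2) ((integrable_const _).add (i3.const_mul _)) ?_
        filter_upwards [ae_restrict_of_ae h1] with x hx
        have b1 : inner ℝ (φ₀ x) (σ x) - δ ≤ inner ℝ (φ x) (σ x) := by
          have h2 : (inner ℝ (φ₀ x) (σ x) : ℝ) - inner ℝ (φ x) (σ x) ≤ δ := by
            rw [← inner_sub_left]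
            refine (real_inner_le_norm _ _).trans ?_
            rw [hx, mul_one, ← dist_eq_norm, dist_comm]
            exact (hφd x).le
          linarith
        have b2 : 1 - 2 * ‖σ x - τ x‖ ≤ inner ℝ (τ' x) (σ x) := by
          have h2 : (inner ℝ (σ x - τ' x) (σ x) : ℝ) ≤ 2 * ‖σ x - τ x‖ := by
            refine (real_inner_le_norm _ _).trans ?_
            rw [hx, mul_one]
            exact norm_smul_inv_max_sub_le _ _ hx
          rw [inner_sub_left, real_inner_self_eq_norm_sq, hx] at h2
          linarith
        have b3 : (inner ℝ (φ₀ x) (σ x) : ℝ) = max (g x - δ) 0 * inner ℝ (τ' x) (σ x) :=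
          real_inner_smul_left _ _ _
        have b4 : max (g x - δ) 0 ≤ M :=
          max_le (by linarith [(le_abs_self _).trans (hM x)]) hM0
        have b5 : 0 ≤ max (g x - δ) 0 := le_max_right _ _
        have b6 : g x - δ ≤ max (g x - δ) 0 := le_max_left _ _
        have b7 := norm_nonneg (σ x - τ x)
        nlinarith [mul_le_mul_of_nonneg_left b2 b5, mul_le_mul_of_nonneg_right b4 b7]
    _ = 2 * δ * m + 2 * M * ∫ x in K, ‖σ x - τ x‖ ∂μ := by
        rw [integral_add (integrable_const _) (i3.const_mul _), integral_const,
          integral_const_mul]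
        simp [hm, Measure.real, mul_comm]
    _ ≤ 2 * δ * m + 2 * M * δ := by gcongr
    _ ≤ ε := by linarith

/-! ### Duality formula, uniqueness of the variation measure, lower semicontinuity. -/

/-- `C^1` fields of compact support dominated by `g`. -/
def IsTestField {d : ℕ} (g : Space d → ℝ) (φ : Space d → Space d) : Prop :=
  ContDiff ℝ 1 φ ∧ HasCompactSupport φ ∧ ∀ x, ‖φ x‖ ≤ g x

/-- The pairing `- ∑ i, ∫ f ∂_i φ_i` of the distributional derivative of `f` with a field `φ`. -/
noncomputable def derivPairing {d : ℕ} (m : Measure (Space d)) (f : Space d → ℝ)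
    (φ : Space d → Space d) : ℝ :=
  -∑ i, ∫ x, f x * fderiv ℝ (fun y => φ y i) x (EuclideanSpace.single i 1) ∂m

theorem tsupport_subset_tsupport_of_eq_zero {α M N : Type*} [TopologicalSpace α] [Zero M] [Zero N]
    {f : α → M} {g : α → N} (h : ∀ x, g x = 0 → f x = 0) : tsupport f ⊆ tsupport g := by
  refine closure_mono fun x hx => ?_
  rw [Function.mem_support] at hx ⊢
  exact mt (h x) hx

theorem contDiff_coord {d : ℕ} {φ : Space d → Space d} (h : ContDiff ℝ 1 φ) (i : Fin d) :
    ContDiff ℝ 1 (fun y => φ y i) :=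
  (contDiff_euclidean.1 h) i

theorem hasCompactSupport_coord {d : ℕ} {φ : Space d → Space d} (h : HasCompactSupport φ)
    (i : Fin d) : HasCompactSupport (fun y => φ y i) :=
  h.comp_left (g := fun v : Space d => v i) rfl

theorem derivPairing_congr {d : ℕ} {m : Measure (Space d)} {f g : Space d → ℝ}
    (h : f =ᵐ[m] g) (φ : Space d → Space d) : derivPairing m f φ = derivPairing m g φ := by
  unfold derivPairing
  congr 1
  refine Finset.sum_congr rfl fun i _ => integral_congr_ae ?_
  filter_upwards [h] with x hx
  rw [hx]

theorem derivPairing_restrict {d : ℕ} {m : Measure (Space d)} (f : Space d → ℝ)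
    {φ : Space d → Space d} {K : Set (Space d)} (hK : tsupport φ ⊆ K) :
    derivPairing (m.restrict K) f φ = derivPairing m f φ := by
  unfold derivPairing
  congr 1
  refine Finset.sum_congr rfl fun i _ => setIntegral_eq_integral_of_forall_compl_eq_zero
    fun x hx => ?_
  have h1 : x ∉ tsupport (fun y => φ y i) := fun h =>
    hx (hK (tsupport_subset_tsupport_of_eq_zero (fun y hy => by simp [hy]) h))
  have h2 := image_eq_zero_of_notMem_tsupport (fun h => h1 (tsupport_fderiv_subset ℝ h))
  rw [h2]
  simp

theorem IsPolarDerivative.derivPairing_eq {d : ℕ} {f : Space d → ℝ} {μ : Measure (Space d)}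
    {σ : Space d → Space d} (h : IsPolarDerivative f μ σ) {φ : Space d → Space d}
    (h1 : ContDiff ℝ 1 φ) (h2 : HasCompactSupport φ) :
    derivPairing volume f φ = ∫ x, inner ℝ (φ x) (σ x) ∂μ := by
  have := h.locallyFinite
  unfold derivPairing
  rw [← Finset.sum_neg_distrib]
  have e : ∀ x, (inner ℝ (φ x) (σ x) : ℝ) = ∑ i, φ x i * σ x i := by
    intro x
    simp [PiLp.inner_apply, mul_comm]
  simp only [e]
  rw [integral_finsetSum]
  · exact Finset.sum_congr rfl fun i _ =>
      h.integral_eq _ (contDiff_coord h1 i) (hasCompactSupport_coord h2 i) i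
  · intro i _
    have hi : Integrable (fun x => φ x i) μ :=
      (contDiff_coord h1 i).continuous.integrable_of_hasCompactSupport (hasCompactSupport_coord h2 i)
    refine hi.mul_bdd (c := 1) ?_ ?_
    · exact ((EuclideanSpace.proj (𝕜 := ℝ) i).continuous.measurable.comp
        h.measurable).aestronglyMeasurable
    · filter_upwards [h.norm_eq_one] with x hx
      rw [← hx]
      exact PiLp.norm_apply_le _ _

/-- The integral of `g ≥ 0` against the variation is a supremum of pairings. -/
theorem IsPolarDerivative.ofReal_integral_eq_iSup {d : ℕ} {f : Space d → ℝ}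
    {μ : Measure (Space d)} {σ : Space d → Space d} (h : IsPolarDerivative f μ σ)
    {g : Space d → ℝ} (hg : Continuous g) (hgs : HasCompactSupport g) (g0 : ∀ x, 0 ≤ g x) :
    ENNReal.ofReal (∫ x, g x ∂μ) =
      ⨆ φ : {φ // IsTestField g φ}, ENNReal.ofReal (derivPairing volume f φ.1) := by
  have := h.locallyFinite
  refine le_antisymm ?_ (iSup_le ?_)
  · refine ENNReal.le_of_forall_pos_le_add fun ε hε _ => ?_
    obtain ⟨φ, h1, h2, h3, h4⟩ := exists_contDiff_integral_inner_ge (F := Space d)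
      h.measurable.aestronglyMeasurable h.norm_eq_one hg hgs g0 (ε := ε) (by exact_mod_cast hε)
    rw [← h.derivPairing_eq h1 h2] at h4
    calc ENNReal.ofReal (∫ x, g x ∂μ)
        ≤ ENNReal.ofReal (derivPairing volume f φ + ε) := ENNReal.ofReal_le_ofReal (by linarith)
      _ ≤ ENNReal.ofReal (derivPairing volume f φ) + ε := by
        refine ENNReal.ofReal_add_le.trans ?_
        simp
      _ ≤ _ := by
        gcongr
        exact le_iSup (fun φ : {φ // IsTestField g φ} =>
          ENNReal.ofReal (derivPairing volume f φ.1)) ⟨φ, h1, h2, h3⟩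
  · rintro ⟨φ, h1, h2, h3⟩
    refine ENNReal.ofReal_le_ofReal ?_
    simp only
    rw [h.derivPairing_eq h1 h2]
    refine (Real.le_norm_self _).trans ((norm_integral_le_of_norm_le
      (hg.integrable_of_hasCompactSupport hgs) ?_))
    filter_upwards [h.norm_eq_one] with x hx
    refine (norm_inner_le_norm _ _).trans ?_
    rw [hx, mul_one]
    exact h3 x

/-- The supremum in the duality formula involves only `f`, so both measures give the same integral
to every nonnegative test function, and to every test function by splitting it into positive and
negative parts. -/
theorem IsPolarDerivative.measure_eq {d : ℕ} {f : Space d → ℝ}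
    {μ μ' : Measure (Space d)} {σ σ' : Space d → Space d} (h : IsPolarDerivative f μ σ)
    (h' : IsPolarDerivative f μ' σ') : μ = μ' := by
  have := h.locallyFinite
  have := h'.locallyFinite
  have key : ∀ g : Space d → ℝ, Continuous g → HasCompactSupport g → (∀ x, 0 ≤ g x) →
      ∫ x, g x ∂μ = ∫ x, g x ∂μ' := by
    intro g hg hgs g0
    have e := (h.ofReal_integral_eq_iSup hg hgs g0).trans
      (h'.ofReal_integral_eq_iSup hg hgs g0).symm
    rwa [ENNReal.ofReal_eq_ofReal_iff (integral_nonneg g0) (integral_nonneg g0)] at e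
  refine Measure.ext_of_integral_eq_on_compactlySupported fun g => ?_
  have hg := g.continuous
  have hgs : HasCompactSupport g := g.hasCompactSupport
  have e : ∀ x, g x = max (g x) 0 - max (-g x) 0 := fun x => (max_zero_sub_eq_self (g x)).symm
  have c1 : Continuous fun x => max (g x) 0 := hg.max continuous_const
  have c2 : Continuous fun x => max (-g x) 0 := hg.neg.max continuous_const
  have s1 : HasCompactSupport fun x => max (g x) 0 :=
    hgs.comp_left (g := fun t : ℝ => max t 0) (by simp)
  have s2 : HasCompactSupport fun x => max (-g x) 0 :=
    hgs.comp_left (g := fun t : ℝ => max (-t) 0) (by simp)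
  rw [integral_congr_ae (Filter.Eventually.of_forall e),
    integral_congr_ae (μ := μ') (Filter.Eventually.of_forall e)]
  rw [integral_sub (c1.integrable_of_hasCompactSupport s1) (c2.integrable_of_hasCompactSupport s2),
    integral_sub (c1.integrable_of_hasCompactSupport s1) (c2.integrable_of_hasCompactSupport s2),
    key _ c1 s1 fun x => le_max_right _ _, key _ c2 s2 fun x => le_max_right _ _]

theorem IsPolarDerivative.variationMeasure_eq {d : ℕ} {f : Space d → ℝ}
    {μ : Measure (Space d)} {σ : Space d → Space d} (h : IsPolarDerivative f μ σ) :
    variationMeasure f = μ := by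
  have : {μ | ∃ σ, IsPolarDerivative f μ σ} = {μ} := by
    ext ν
    exact ⟨fun ⟨_, h'⟩ => h'.measure_eq h, fun e => ⟨σ, by rw [mem_singleton_iff.1 e]; exact h⟩⟩
  rw [variationMeasure, this, sInf_singleton]

theorem HasLocallyBoundedVariation.isLocallyFiniteMeasure {d : ℕ} {f : Space d → ℝ}
    (h : HasLocallyBoundedVariation f) : IsLocallyFiniteMeasure (variationMeasure f) := by
  obtain ⟨μ, σ, h⟩ := h
  rw [h.variationMeasure_eq]
  exact h.locallyFinite

/-- The supremum of the pairings with fields dominated by `g`, as a function on `L^1(m)`. -/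
noncomputable def lpVariation {d : ℕ} (m : Measure (Space d)) (g : Space d → ℝ) (u : Lp ℝ 1 m) :
    ℝ≥0∞ :=
  ⨆ φ : {φ // IsTestField g φ}, ENNReal.ofReal (derivPairing m u φ.1)

theorem continuous_integral_mul_right {α : Type*} [MeasurableSpace α] {m : Measure α} {c : α → ℝ}
    (hc : AEStronglyMeasurable c m) {C : ℝ} (hC : ∀ x, ‖c x‖ ≤ C) :
    Continuous fun u : Lp ℝ 1 m => ∫ x, u x * c x ∂m := by
  have hi : ∀ u : Lp ℝ 1 m, Integrable (fun x => u x * c x) m := fun u =>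
    (L1.integrable_coeFn u).mul_bdd hc (Filter.Eventually.of_forall hC)
  refine (LipschitzWith.of_dist_le_mul (K := C.toNNReal) fun u v => ?_).continuous
  rw [dist_eq_norm, ← integral_sub (hi u) (hi v), dist_eq_norm, L1.norm_eq_integral_norm,
    ← integral_const_mul]
  refine norm_integral_le_of_norm_le ((L1.integrable_coeFn _).norm.const_mul _) ?_
  filter_upwards [Lp.coeFn_sub u v] with x hx
  rw [hx, Pi.sub_apply, ← sub_mul, norm_mul, mul_comm]
  exact mul_le_mul_of_nonneg_right ((hC x).trans (Real.le_coe_toNNReal _)) (norm_nonneg _)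

/-- Each pairing is continuous on `L^1(m)`, since the derivatives of a test field are bounded; a
supremum of continuous functions is lower semicontinuous. -/
theorem lowerSemicontinuous_lpVariation {d : ℕ} (m : Measure (Space d)) (g : Space d → ℝ) :
    LowerSemicontinuous (lpVariation m g) := by
  refine lowerSemicontinuous_iSup fun φ => Continuous.lowerSemicontinuous ?_
  refine ENNReal.continuous_ofReal.comp (Continuous.neg (continuous_finsetSum _ fun i _ => ?_))
  obtain ⟨φ, h1, h2, -⟩ := φ
  have hc : Continuous fun x => fderiv ℝ (fun y => φ y i) x (EuclideanSpace.single i 1) :=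
    ((contDiff_coord h1 i).continuous_fderiv one_ne_zero).clm_apply continuous_const
  have hs : HasCompactSupport fun x => fderiv ℝ (fun y => φ y i) x (EuclideanSpace.single i 1) :=
    (hasCompactSupport_coord h2 i).fderiv_apply ℝ _
  obtain ⟨C, hC⟩ := hc.bounded_above_of_compact_support hs
  exact continuous_integral_mul_right hc.aestronglyMeasurable hC

/-- Fields dominated by `g` are supported in `K`, so the variation tested by `g` is a function of
the class in `L^1(K)` alone. This is how variation is later controlled by restrictions to balls. -/
theorem HasLocallyBoundedVariation.ofReal_integral_eq_lpVariation {d : ℕ} {f : Space d → ℝ}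
    (h : HasLocallyBoundedVariation f) {g : Space d → ℝ} (hg : Continuous g)
    (hgs : HasCompactSupport g) (g0 : ∀ x, 0 ≤ g x) {K : Set (Space d)} (hK : tsupport g ⊆ K)
    {u : Lp ℝ 1 ((volume : Measure (Space d)).restrict K)} (hu : u =ᵐ[volume.restrict K] f) :
    ENNReal.ofReal (∫ x, g x ∂(variationMeasure f)) = lpVariation (volume.restrict K) g u := by
  obtain ⟨μ, σ, h⟩ := h
  rw [h.variationMeasure_eq, h.ofReal_integral_eq_iSup hg hgs g0]
  refine iSup_congr fun φ => ?_
  have hs : tsupport φ.1 ⊆ K := by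
    exact (tsupport_subset_tsupport_of_eq_zero fun x hx =>
      norm_le_zero_iff.1 ((φ.2.2.2 x).trans hx.le)).trans hK
  rw [derivPairing_congr hu, derivPairing_restrict f hs]

/-! ### Derivative bounds and difference quotients; stability under unions. -/

/-- The distributional derivative of `f` in direction `e` is dominated by the measure `μ`. -/
def DerivLE {d : ℕ} (f : Space d → ℝ) (e : Space d) (μ : Measure (Space d)) : Prop :=
  ∀ φ : Space d → ℝ, ContDiff ℝ 1 φ → HasCompactSupport φ →
    |∫ x, f x * fderiv ℝ φ x e| ≤ ∫ x, |φ x| ∂μ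

theorem IsPolarDerivative.derivLE {d : ℕ} {f : Space d → ℝ} {μ : Measure (Space d)}
    {σ : Space d → Space d} (h : IsPolarDerivative f μ σ) (i : Fin d) :
    DerivLE f (EuclideanSpace.single i 1) μ := by
  intro φ h1 h2
  have := h.locallyFinite
  rw [← abs_neg, h.integral_eq φ h1 h2 i]
  have hi : Integrable (fun x => |φ x|) μ := (h1.continuous.integrable_of_hasCompactSupport h2).norm
  rw [← Real.norm_eq_abs]
  refine norm_integral_le_of_norm_le hi ?_
  filter_upwards [h.norm_eq_one] with x hx
  rw [norm_mul]
  refine mul_le_of_le_one_right (norm_nonneg _) ?_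
  rw [← hx]
  exact PiLp.norm_apply_le _ _

theorem DerivLE.congr {d : ℕ} {f g : Space d → ℝ} {e : Space d} {μ : Measure (Space d)}
    (h : DerivLE f e μ) (hfg : f =ᵐ[volume] g) : DerivLE g e μ := by
  intro φ h1 h2
  convert h φ h1 h2 using 2
  refine integral_congr_ae ?_
  filter_upwards [hfg] with x hx
  rw [hx]

theorem hasCompactSupport_comp_sub_const {d : ℕ} {φ : Space d → ℝ} (h : HasCompactSupport φ)
    (z : Space d) : HasCompactSupport fun x => φ (x - z) :=
  h.comp_homeomorph (Homeomorph.subRight z)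

/-- Differentiation under the integral sign. For `t` within 1 of `t₀` all shifted supports stay in
one compact set, on which the derivative of `φ` is bounded and `f` is integrable. -/
theorem hasDerivAt_integral_mul_comp_sub {d : ℕ} {f : Space d → ℝ}
    (hf : LocallyIntegrable f volume) {φ : Space d → ℝ} (h1 : ContDiff ℝ 1 φ)
    (h2 : HasCompactSupport φ) (e : Space d) (t₀ : ℝ) :
    HasDerivAt (fun t : ℝ => ∫ x, f x * φ (x - t • e))
      (∫ x, f x * -fderiv ℝ φ (x - t₀ • e) e) t₀ := by
  have hc : Continuous fun x => fderiv ℝ φ x e :=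
    (h1.continuous_fderiv one_ne_zero).clm_apply continuous_const
  obtain ⟨C, hC⟩ := hc.bounded_above_of_compact_support (h2.fderiv_apply ℝ e)
  have hC0 : 0 ≤ C := (norm_nonneg _).trans (hC 0)
  set K := Metric.cthickening ((|t₀| + 1) * ‖e‖) (tsupport φ) with hK
  have hKc : IsCompact K := IsCompact.cthickening h2
  have hmem : ∀ t ∈ Metric.ball t₀ 1, ∀ x ∉ K, x - t • e ∉ tsupport φ := by
    intro t ht x hx hx'
    refine hx (Metric.mem_cthickening_of_dist_le x _ _ _ hx' ?_)
    rw [dist_eq_norm, sub_sub_cancel, norm_smul]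
    refine mul_le_mul_of_nonneg_right ?_ (norm_nonneg _)
    rw [Metric.mem_ball, Real.dist_eq] at ht
    have := abs_sub_abs_le_abs_sub t t₀
    rw [Real.norm_eq_abs]
    linarith
  have hcomp : ∀ t : ℝ, Continuous fun x : Space d => x - t • e := fun t =>
    continuous_id.sub continuous_const
  refine (hasDerivAt_integral_of_dominated_loc_of_deriv_le
    (F := fun t x => f x * φ (x - t • e))
    (F' := fun t x => f x * -fderiv ℝ φ (x - t • e) e) (bound := K.indicator fun x => ‖f x‖ * C) (Metric.ball_mem_nhds t₀ one_pos)
    (Filter.Eventually.of_forall fun t => hf.aestronglyMeasurable.mul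
      (h1.continuous.comp (hcomp t)).aestronglyMeasurable) ?_ ?_ ?_ ?_ ?_).2
  · have hcs := hasCompactSupport_comp_sub_const h2 (t₀ • e)
    have := hf.integrable_smul_right_of_hasCompactSupport (h1.continuous.comp (hcomp t₀)) hcs
    simpa using this
  · exact hf.aestronglyMeasurable.mul (hc.comp (hcomp t₀)).neg.aestronglyMeasurable
  · refine Filter.Eventually.of_forall fun x t ht => ?_
    by_cases hx : x ∈ K
    · rw [indicator_of_mem hx, norm_mul, norm_neg]
      exact mul_le_mul_of_nonneg_left (hC _) (norm_nonneg _)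
    · rw [image_eq_zero_of_notMem_tsupport fun h => hmem t ht x hx (tsupport_fderiv_subset ℝ h)]
      simp [indicator_of_notMem hx]
  · exact (integrable_indicator_iff hKc.measurableSet).2
      ((hf.integrableOn_isCompact hKc).norm.mul_const C)
  · refine Filter.Eventually.of_forall fun x t _ => HasDerivAt.const_mul _ ?_
    have h3 : HasFDerivAt φ (fderiv ℝ φ (x - t • e)) (x - t • e) :=
      (h1.differentiable one_ne_zero _).hasFDerivAt
    have h4 : HasDerivAt (fun t : ℝ => x - t • e) (-e) t := by
      simpa using ((hasDerivAt_id t).smul_const e).const_sub x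
    have h5 := h3.comp_hasDerivAt t h4
    rw [map_neg] at h5
    exact h5

/-- Mean value inequality in the shift: the derivative at `t` is up to sign the pairing with the
translate of `φ` by `t • e`, and `ψ` majorizes all these translates. -/
theorem DerivLE.abs_integral_comp_sub_sub_le {d : ℕ} {f : Space d → ℝ} {e : Space d}
    {μ : Measure (Space d)} (h : DerivLE f e μ) (hf : LocallyIntegrable f volume)
    {φ : Space d → ℝ} (h1 : ContDiff ℝ 1 φ) (h2 : HasCompactSupport φ) {s : ℝ} (hs : 0 ≤ s)
    {ψ : Space d → ℝ} (hψ : Integrable ψ μ) (hφψ : ∀ t ∈ Icc 0 s, ∀ x, |φ (x - t • e)| ≤ ψ x) :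
    |(∫ x, f x * φ (x - s • e)) - ∫ x, f x * φ x| ≤ s * ∫ x, ψ x ∂μ := by
  have key := norm_image_sub_le_of_norm_deriv_le_segment' (a := 0) (b := s) (C := ∫ x, ψ x ∂μ)
    (fun t _ => (hasDerivAt_integral_mul_comp_sub hf h1 h2 e t).hasDerivWithinAt) ?_ s
    (right_mem_Icc.2 hs)
  · simpa [mul_comm] using key
  · intro t ht
    have hcs := hasCompactSupport_comp_sub_const h2 (t • e)
    have h3 := h (fun x => φ (x - t • e)) (h1.comp (contDiff_id.sub contDiff_const)) hcs
    simp only [fderiv_comp_sub] at h3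
    simp only [mul_neg, integral_neg, norm_neg]
    refine h3.trans (integral_mono_of_nonneg (Filter.Eventually.of_forall fun x => abs_nonneg _) hψ
      (Filter.Eventually.of_forall fun x => hφψ t (Ico_subset_Icc_self ht) x))

theorem LocallyIntegrable.comp_add_const {d : ℕ} {f : Space d → ℝ}
    (hf : LocallyIntegrable f volume) (z : Space d) :
    LocallyIntegrable (fun x => f (x + z)) volume := by
  intro x
  obtain ⟨s, hs, hi⟩ := hf (x + z)
  exact ⟨(fun y => y + z) ⁻¹' s,
    (continuous_id.add continuous_const).continuousAt.preimage_mem_nhds hs,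
    ((measurePreserving_add_right volume z).integrableOn_comp_preimage
      (measurableEmbedding_addRight z)).2 hi⟩

theorem isLocallyFiniteMeasure_withDensity_enorm {d : ℕ} {E : Type*} [NormedAddCommGroup E]
    {m : Measure (Space d)} {u : Space d → E} (hu : LocallyIntegrable u m) :
    IsLocallyFiniteMeasure (m.withDensity fun x => ‖u x‖ₑ) := by
  refine ⟨fun x => ?_⟩
  obtain ⟨s, hs, hi⟩ := hu x
  obtain ⟨t, hts, ht, hxt⟩ := mem_nhds_iff.1 hs
  refine ⟨t, ht.mem_nhds hxt, ?_⟩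
  rw [withDensity_apply _ ht.measurableSet]
  exact (hi.mono_set hts).2

/-- With `u` the difference, the left side is `∫ g |u|`. Approximating the unit field `sign u` for
the measure `|u| dx` by `C^1` functions dominated by `g` reduces it to `∫ u φ`; moving the shift
onto `φ` makes the mean value inequality apply. -/
theorem DerivLE.lintegral_enorm_sub_mul_le {d : ℕ} {f : Space d → ℝ} {e : Space d}
    {μ : Measure (Space d)} (h : DerivLE f e μ) (hf : LocallyIntegrable f volume)
    (hfm : Measurable f) {g : Space d → ℝ} (hg : Continuous g) (hgs : HasCompactSupport g)
    (g0 : ∀ x, 0 ≤ g x) {s : ℝ} (hs : 0 ≤ s)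
    {ψ : Space d → ℝ} (hψ : Integrable ψ μ) (hφψ : ∀ t ∈ Icc 0 s, ∀ x, g (x - t • e) ≤ ψ x) :
    ∫⁻ x, ‖f (x + s • e) - f x‖ₑ * ENNReal.ofReal (g x) ≤
      ENNReal.ofReal s * ∫⁻ x, ENNReal.ofReal (ψ x) ∂μ := by
  set u : Space d → ℝ := fun x => f (x + s • e) - f x with hu
  have hul : LocallyIntegrable u volume := (LocallyIntegrable.comp_add_const hf _).sub hf
  have hum : Measurable u := (hfm.comp (measurable_add_const _)).sub hfm
  set ν : Measure (Space d) := volume.withDensity fun x => ‖u x‖ₑ with hν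
  have hlf : IsLocallyFiniteMeasure ν := isLocallyFiniteMeasure_withDensity_enorm hul
  have hσ : Measurable fun x => Real.sign (u x) := by
    have : Measurable Real.sign := by
      refine Measurable.ite measurableSet_Iio measurable_const
        (Measurable.ite measurableSet_Ioi measurable_const measurable_const)
    exact this.comp hum
  have h1 : ∀ᵐ x ∂ν, ‖Real.sign (u x)‖ = 1 := by
    rw [ae_withDensity_iff hum.enorm]
    refine Filter.Eventually.of_forall fun x hx => ?_
    have hx' : u x ≠ 0 := by simpa using hx
    rcases Real.sign_apply_eq_of_ne_zero _ hx' with h | h <;> simp [h]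
  have hψ0 : ∀ x, 0 ≤ ψ x := fun x => (g0 _).trans (hφψ 0 ⟨le_rfl, hs⟩ x)
  have key : ∫ x, g x ∂ν ≤ s * ∫ x, ψ x ∂μ := by
    refine le_of_forall_pos_le_add fun ε hε => ?_
    obtain ⟨φ, c1, c2, c3, c4⟩ := exists_contDiff_integral_inner_ge (F := ℝ)
      hσ.aestronglyMeasurable h1 hg hgs g0 hε
    have e1 : ∫ x, (inner ℝ (φ x) (Real.sign (u x)) : ℝ) ∂ν =
        (∫ x, f x * φ (x - s • e)) - ∫ x, f x * φ x := by
      rw [hν, integral_withDensity_eq_integral_toReal_smul hum.enorm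
        (Filter.Eventually.of_forall fun x => enorm_lt_top)]
      have e2 : ∫ x, f x * φ (x - s • e) = ∫ x, f (x + s • e) * φ x := by
        rw [← integral_add_right_eq_self _ (s • e)]
        simp
      rw [e2, ← integral_sub]
      · refine integral_congr_ae (Filter.Eventually.of_forall fun x => ?_)
        simp only [toReal_enorm, smul_eq_mul, ← sub_mul]
        have : Real.sign (u x) * |u x| = u x := by
          rcases lt_trichotomy (u x) 0 with h | h | h
          · rw [Real.sign_of_neg h, abs_of_neg h]; ring
          · simp [h]
          · rw [Real.sign_of_pos h, abs_of_pos h]; ring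
        simp only [Real.norm_eq_abs, RCLike.inner_apply, conj_trivial]
        rw [← hu] at *
        calc |u x| * (Real.sign (u x) * φ x) = Real.sign (u x) * |u x| * φ x := by ring
          _ = u x * φ x := by rw [this]
      · have := (LocallyIntegrable.comp_add_const hf (s • e)
          ).integrable_smul_right_of_hasCompactSupport c1.continuous c2
        simpa using this
      · have := hf.integrable_smul_right_of_hasCompactSupport c1.continuous c2
        simpa using this
    rw [e1] at c4
    have c5 := h.abs_integral_comp_sub_sub_le hf c1 c2 hs hψ
      fun t ht x => (c3 _).trans (hφψ t ht x)
    have := le_abs_self ((∫ x, f x * φ (x - s • e)) - ∫ x, f x * φ x)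
    linarith
  have e3 : ∫⁻ x, ‖f (x + s • e) - f x‖ₑ * ENNReal.ofReal (g x) =
      ∫⁻ x, ENNReal.ofReal (g x) ∂ν := by
    rw [hν, lintegral_withDensity_eq_lintegral_mul _ hum.enorm hg.measurable.ennreal_ofReal]
    rfl
  rw [e3, ← ofReal_integral_eq_lintegral_ofReal (hg.integrable_of_hasCompactSupport hgs)
    (Filter.Eventually.of_forall g0), ← ofReal_integral_eq_lintegral_ofReal hψ
    (Filter.Eventually.of_forall hψ0), ← ENNReal.ofReal_mul hs]
  exact ENNReal.ofReal_le_ofReal key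

theorem locallyIntegrable_indicator_one {d : ℕ} {S : Set (Space d)} (hS : MeasurableSet S) :
    LocallyIntegrable (S.indicator (1 : Space d → ℝ)) volume :=
  (locallyIntegrable_const (1 : ℝ)).indicator hS

/-- If the union separates `x` from `y`, then so does one of the sets. -/
theorem enorm_indicator_iUnion_sub_le {α ι : Type*} (S : ι → Set α) (x y : α) :
    ‖(⋃ j, S j).indicator (1 : α → ℝ) x - (⋃ j, S j).indicator 1 y‖ₑ ≤
      ∑' j, ‖(S j).indicator (1 : α → ℝ) x - (S j).indicator 1 y‖ₑ := by
  by_cases hx : x ∈ ⋃ j, S j <;> by_cases hy : y ∈ ⋃ j, S j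
  · simp [indicator_of_mem hx, indicator_of_mem hy]
  · obtain ⟨j, hj⟩ := mem_iUnion.1 hx
    have hj' : y ∉ S j := fun h => hy (mem_iUnion.2 ⟨j, h⟩)
    refine le_trans ?_ (ENNReal.le_tsum j)
    simp [indicator_of_mem hx, indicator_of_notMem hy, indicator_of_mem hj,
      indicator_of_notMem hj']
  · obtain ⟨j, hj⟩ := mem_iUnion.1 hy
    have hj' : x ∉ S j := fun h => hx (mem_iUnion.2 ⟨j, h⟩)
    refine le_trans ?_ (ENNReal.le_tsum j)
    simp [indicator_of_mem hy, indicator_of_notMem hx, indicator_of_mem hj,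
      indicator_of_notMem hj']
  · simp [indicator_of_notMem hx, indicator_of_notMem hy]

/-- The derivative of the indicator of a countable union is dominated by the sum of the bounds. -/
theorem DerivLE.iUnion {d : ℕ} {ι : Type*} [Countable ι] {S : ι → Set (Space d)} {e : Space d}
    {μ : ι → Measure (Space d)} (hS : ∀ j, MeasurableSet (S j))
    (h : ∀ j, DerivLE ((S j).indicator 1) e (μ j)) [IsLocallyFiniteMeasure (Measure.sum μ)] :
    DerivLE ((⋃ j, S j).indicator 1) e (Measure.sum μ) := by
  intro φ h1 h2
  set f : Space d → ℝ := (⋃ j, S j).indicator 1 with hf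
  have hfm : MeasurableSet (⋃ j, S j) := MeasurableSet.iUnion hS
  have hfl : LocallyIntegrable f volume := locallyIntegrable_indicator_one hfm
  set ν := Measure.sum μ with hν
  set K := Metric.cthickening ‖e‖ (tsupport φ) with hK
  have hKc : IsCompact K := IsCompact.cthickening h2
  have hKf : ν K < ∞ := hKc.measure_lt_top
  have habs : Continuous fun x => |φ x| := h1.continuous.abs
  have habss : HasCompactSupport fun x => |φ x| := h2.comp_left abs_zero
  -- The pairing is recovered as the limit of difference quotients; right-sided ones suffice,
  -- matching the estimate for `s ≥ 0`.
  have hderiv := (hasDerivAt_integral_mul_comp_sub hfl h1 h2 e 0).tendsto_slope_zero_right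
  simp only [zero_smul, sub_zero, mul_neg, integral_neg, zero_add] at hderiv
  have main : ∀ η > 0, |∫ x, f x * fderiv ℝ φ x e| ≤ ∫ x, |φ x| ∂ν + η * (ν K).toReal := by
    intro η hη
    -- By uniform continuity a small shift changes `|φ|` by less than `η`, and a shift by at most
    -- `‖e‖` keeps the support inside `K`. Hence `ψ` majorizes all small translates, at the extra
    -- cost `η ν(K)`.
    set ψ : Space d → ℝ := K.indicator fun x => |φ x| + η with hψ
    have hψi : Integrable ψ ν := (integrable_indicator_iff hKc.measurableSet).2
      ((habs.add continuous_const).continuousOn.integrableOn_compact hKc)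
    have hψint : ∫ x, ψ x ∂ν = ∫ x, |φ x| ∂ν + η * (ν K).toReal := by
      rw [hψ, integral_indicator hKc.measurableSet, integral_add
        (habs.integrable_of_hasCompactSupport habss).integrableOn
        (integrableOn_const hKf.ne), setIntegral_eq_integral_of_forall_compl_eq_zero]
      · simp [Measure.real, mul_comm]
      · intro x hx
        rw [image_eq_zero_of_notMem_tsupport fun h => hx (Metric.self_subset_cthickening _ h),
          abs_zero]
    have huc := habss.uniformContinuous_of_continuous habs
    obtain ⟨δ, hδ, hδφ⟩ := Metric.uniformContinuous_iff.1 huc η hη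
    have hbd : ∀ t : ℝ, 0 ≤ t → t ≤ 1 → t * ‖e‖ < δ → ∀ x, |φ (x - t • e)| ≤ ψ x := by
      intro t ht ht1 htδ x
      have hd : dist x (x - t • e) = t * ‖e‖ := by
        rw [dist_eq_norm, sub_sub_cancel, norm_smul, Real.norm_of_nonneg ht]
      by_cases hx : x ∈ K
      · rw [hψ, indicator_of_mem hx]
        have := hδφ (a := x) (b := x - t • e) (by rw [hd]; exact htδ)
        rw [Real.dist_eq, abs_lt] at this
        linarith [this.1]
      · have hx' : x - t • e ∉ tsupport φ := by
          intro hx'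
          refine hx (Metric.mem_cthickening_of_dist_le x _ _ _ hx' ?_)
          rw [hd]
          exact mul_le_of_le_one_left (norm_nonneg _) ht1
        rw [hψ, indicator_of_notMem hx, image_eq_zero_of_notMem_tsupport hx', abs_zero]
    have hev : ∀ᶠ s : ℝ in 𝓝[>] 0, 0 < s ∧ s ≤ 1 ∧ s * ‖e‖ < δ := by
      have a1 : ∀ᶠ s : ℝ in 𝓝[>] 0, s * ‖e‖ < δ := by
        have : Filter.Tendsto (fun s : ℝ => s * ‖e‖) (𝓝 0) (𝓝 (0 * ‖e‖)) :=
          (continuous_id.mul continuous_const).tendsto 0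
        rw [zero_mul] at this
        exact (this.mono_left nhdsWithin_le_nhds).eventually (gt_mem_nhds hδ)
      have a2 : ∀ᶠ s : ℝ in 𝓝[>] 0, s ≤ 1 := nhdsWithin_le_nhds (Iic_mem_nhds one_pos)
      filter_upwards [a1, a2, self_mem_nhdsWithin] with s b1 b2 b3 using ⟨b3, b2, b1⟩
    rw [← hψint, ← abs_neg]
    refine le_of_tendsto hderiv.norm ?_
    filter_upwards [hev] with s hs
    obtain ⟨s0, s1, s2⟩ := hs
    have hb : ∀ t ∈ Icc 0 s, ∀ x, |φ (x - t • e)| ≤ ψ x := fun t ht x =>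
      hbd t ht.1 (ht.2.trans s1)
        ((mul_le_mul_of_nonneg_right ht.2 (norm_nonneg _)).trans_lt s2) x
    have hψ0 : ∀ x, 0 ≤ ψ x := fun x => (abs_nonneg _).trans (hb 0 ⟨le_rfl, s0.le⟩ x)
    have e2 : (∫ x, f x * φ (x - s • e)) - ∫ x, f x * φ x =
        ∫ x, (f (x + s • e) - f x) * φ x := by
      rw [← integral_add_right_eq_self _ (s • e)]
      simp only [add_sub_cancel_right, sub_mul]
      rw [integral_sub]
      · have := (LocallyIntegrable.comp_add_const hfl (s • e)
          ).integrable_smul_right_of_hasCompactSupport h1.continuous h2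
        simpa using this
      · have := hfl.integrable_smul_right_of_hasCompactSupport h1.continuous h2
        simpa using this
    have e3 : ‖∫ x, (f (x + s • e) - f x) * φ x‖ₑ ≤ ENNReal.ofReal (s * ∫ x, ψ x ∂ν) := by
      calc ‖∫ x, (f (x + s • e) - f x) * φ x‖ₑ
          ≤ ∫⁻ x, ‖(f (x + s • e) - f x) * φ x‖ₑ := enorm_integral_le_lintegral_enorm _
        _ ≤ ∫⁻ x, ∑' j, ‖(S j).indicator (1 : Space d → ℝ) (x + s • e) - (S j).indicator 1 x‖ₑ *
              ENNReal.ofReal |φ x| := by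
            refine lintegral_mono fun x => ?_
            rw [enorm_mul, ENNReal.tsum_mul_right, ← Real.enorm_eq_ofReal_abs]
            gcongr
            exact enorm_indicator_iUnion_sub_le S _ _
        _ = ∑' j, ∫⁻ x, ‖(S j).indicator (1 : Space d → ℝ) (x + s • e) -
              (S j).indicator 1 x‖ₑ * ENNReal.ofReal |φ x| := by
            refine lintegral_tsum fun j => Measurable.aemeasurable (Measurable.mul (f := fun x =>
                ‖(S j).indicator (1 : Space d → ℝ) (x + s • e) - (S j).indicator 1 x‖ₑ) ?_ ?_)
            · exact (((measurable_one.indicator (hS j)).comp (measurable_add_const _)).sub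
                (measurable_one.indicator (hS j))).enorm
            · exact habs.measurable.ennreal_ofReal
        _ ≤ ∑' j, ENNReal.ofReal s * ∫⁻ x, ENNReal.ofReal (ψ x) ∂(μ j) := by
            refine ENNReal.tsum_le_tsum fun j => ?_
            exact (h j).lintegral_enorm_sub_mul_le (locallyIntegrable_indicator_one (hS j))
              (measurable_one.indicator (hS j)) habs habss (fun x => abs_nonneg _) s0.le
              (hψi.mono_measure (Measure.le_sum μ j)) hb
        _ = ENNReal.ofReal (s * ∫ x, ψ x ∂ν) := by
            rw [ENNReal.tsum_mul_left, ← lintegral_sum_measure, ENNReal.ofReal_mul s0.le,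
              ofReal_integral_eq_lintegral_ofReal hψi (Filter.Eventually.of_forall hψ0)]
    rw [e2, norm_smul, norm_inv, Real.norm_of_nonneg s0.le, inv_mul_le_iff₀ s0]
    rw [← ofReal_norm, ENNReal.ofReal_le_ofReal_iff
      (mul_nonneg s0.le (integral_nonneg hψ0))] at e3
    exact e3
  refine le_of_forall_pos_le_add fun ε hε => ?_
  have hm : 0 ≤ (ν K).toReal := ENNReal.toReal_nonneg
  refine (main (ε / ((ν K).toReal + 1)) (by positivity)).trans ?_
  gcongr
  rw [div_mul_eq_mul_div, div_le_iff₀ (by positivity)]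
  nlinarith

/-! ### Riesz representation through a weighted `L^2` space. -/

/-- A functional bounded by `‖T ·‖`, for a linear map `T` to a Hilbert space, is represented by a
vector. -/
theorem exists_forall_eq_inner_of_abs_le {V H : Type*} [AddCommGroup V] [Module ℝ V]
    [NormedAddCommGroup H] [InnerProductSpace ℝ H] [CompleteSpace H] (T : V →ₗ[ℝ] H)
    (L : V →ₗ[ℝ] ℝ) (C : ℝ) (hL : ∀ v, |L v| ≤ C * ‖T v‖) :
    ∃ h : H, ∀ v, L v = inner ℝ h (T v) := by
  -- A linear section of `T` over its range. The bound makes `L` vanish on the kernel of `T`, so the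
  -- choice of section does not matter.
  obtain ⟨s, hs⟩ := T.rangeRestrict.exists_rightInverse_of_surjective T.range_rangeRestrict
  have hs' : ∀ y : LinearMap.range T, T (s y) = y := fun y =>
    congrArg Subtype.val (LinearMap.congr_fun hs y)
  let ℓ : LinearMap.range T →L[ℝ] ℝ := (L.comp s).mkContinuous C fun y => by
    have := hL (s y)
    rw [hs'] at this
    exact this
  obtain ⟨g, hg, -⟩ := exists_extension_norm_eq (LinearMap.range T) ℓ
  refine ⟨(InnerProductSpace.toDual ℝ H).symm g, fun v => ?_⟩
  rw [InnerProductSpace.toDual_symm_apply]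
  have h1 := hg ⟨T v, LinearMap.mem_range_self T v⟩
  simp only at h1
  rw [h1]
  have h2 : L (s ⟨T v, LinearMap.mem_range_self T v⟩ - v) = 0 := by
    have := hL (s ⟨T v, LinearMap.mem_range_self T v⟩ - v)
    rw [map_sub T, hs', sub_self, norm_zero, mul_zero] at this
    exact abs_nonpos_iff.1 this
  rw [map_sub, sub_eq_zero] at h2
  exact h2.symm

/-- The weight is constant on the shells where `⌈‖x‖⌉ = n`, and divides by `2^n` times the mass of
the ball, so shell `n` contributes at most `2^(-n)`. Monotonicity of `b` bounds the inverse weight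
on balls. -/
theorem exists_weight {d : ℕ} (μ : Measure (Space d)) [IsLocallyFiniteMeasure μ] :
    ∃ w : Space d → ℝ, Measurable w ∧ (∀ x, 0 < w x) ∧
      ∫⁻ x, ENNReal.ofReal (w x) ∂μ < ∞ ∧ ∀ r, ∃ C, ∀ x, ‖x‖ ≤ r → (w x)⁻¹ ≤ C := by
  set b : ℕ → ℝ := fun n => 2 ^ n * (1 + (μ (Metric.closedBall 0 n)).toReal) with hb
  have hball : ∀ n : ℕ, μ (Metric.closedBall 0 n) ≠ ∞ := fun n =>
    (isCompact_closedBall (0 : Space d) n).measure_lt_top.ne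
  have hb0 : ∀ n, 0 < b n := fun n => by positivity
  have hbm : Monotone b := by
    intro n k hnk
    have h1 : (μ (Metric.closedBall 0 n)).toReal ≤ (μ (Metric.closedBall 0 k)).toReal :=
      ENNReal.toReal_mono (hball k)
        (measure_mono (Metric.closedBall_subset_closedBall (by exact_mod_cast hnk)))
    have h2 : (2 : ℝ) ^ n ≤ 2 ^ k := pow_le_pow_right₀ one_le_two hnk
    simp only [hb]
    gcongr
  set N : Space d → ℕ := fun x => ⌈‖x‖⌉₊ with hN
  have hNm : Measurable N := Nat.measurable_ceil.comp measurable_norm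
  refine ⟨fun x => (b (N x))⁻¹, ?_, fun x => inv_pos.2 (hb0 _), ?_, fun r => ⟨b ⌈r⌉₊, fun x hx => ?_⟩⟩
  · exact (measurable_from_nat (f := fun n => (b n)⁻¹)).comp hNm
  · rw [← lintegral_map (f := fun n => ENNReal.ofReal (b n)⁻¹) measurable_from_nat hNm,
      lintegral_countable']
    have hle : ∀ n, ENNReal.ofReal (b n)⁻¹ * (μ.map N) {n} ≤ (2⁻¹ : ℝ≥0∞) ^ n := by
      intro n
      rw [Measure.map_apply hNm (measurableSet_singleton n)]
      have h1 : μ (N ⁻¹' {n}) ≤ μ (Metric.closedBall 0 n) := by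
        refine measure_mono fun x hx => ?_
        have hx' : N x = n := hx
        rw [mem_closedBall_zero_iff, ← hx']
        exact Nat.le_ceil _
      have h2 : (b n)⁻¹ * (μ (Metric.closedBall 0 n)).toReal ≤ (2⁻¹ : ℝ) ^ n := by
        rw [inv_mul_le_iff₀ (hb0 n), hb]
        simp only
        rw [mul_right_comm, ← mul_pow]
        norm_num
      calc ENNReal.ofReal (b n)⁻¹ * μ (N ⁻¹' {n})
          ≤ ENNReal.ofReal (b n)⁻¹ * μ (Metric.closedBall 0 n) := by gcongr
        _ = ENNReal.ofReal ((b n)⁻¹ * (μ (Metric.closedBall 0 n)).toReal) := by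
          rw [ENNReal.ofReal_mul (inv_pos.2 (hb0 n)).le, ENNReal.ofReal_toReal (hball n)]
        _ ≤ ENNReal.ofReal ((2⁻¹ : ℝ) ^ n) := ENNReal.ofReal_le_ofReal h2
        _ = (2⁻¹ : ℝ≥0∞) ^ n := by
          rw [ENNReal.ofReal_pow (by norm_num), ENNReal.ofReal_inv_of_pos two_pos]
          norm_num
    refine (ENNReal.tsum_le_tsum hle).trans_lt ?_
    rw [ENNReal.tsum_geometric]
    simp
  · rw [inv_inv]
    exact hbm (Nat.ceil_mono hx)

/-- The `C^1` functions of compact support. -/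
def testFunctions (d : ℕ) : Submodule ℝ (Space d → ℝ) where
  carrier := {φ | ContDiff ℝ 1 φ ∧ HasCompactSupport φ}
  add_mem' h h' := ⟨h.1.add h'.1, h.2.add h'.2⟩
  zero_mem' := ⟨contDiff_const, HasCompactSupport.zero⟩
  smul_mem' c _ h := ⟨h.1.const_smul c, h.2.smul_left (f := fun _ => c)⟩

theorem memLp_of_mem_testFunctions {d : ℕ} {m : Measure (Space d)} [IsLocallyFiniteMeasure m]
    {φ : Space d → ℝ} (h : φ ∈ testFunctions d) : MemLp φ 2 m :=
  h.1.continuous.memLp_of_hasCompactSupport h.2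

/-- The class in `L^2(m)` of a test function. -/
noncomputable def testFunctionsToL2 {d : ℕ} (m : Measure (Space d)) [IsLocallyFiniteMeasure m] :
    testFunctions d →ₗ[ℝ] Lp ℝ 2 m where
  toFun φ := (memLp_of_mem_testFunctions φ.2).toLp φ.1
  map_add' φ ψ := MemLp.toLp_add (memLp_of_mem_testFunctions φ.2) (memLp_of_mem_testFunctions ψ.2)
  map_smul' c φ := MemLp.toLp_const_smul c (memLp_of_mem_testFunctions φ.2)

theorem integrable_mul_fderiv {d : ℕ} {f : Space d → ℝ} (hf : LocallyIntegrable f volume)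
    {φ : Space d → ℝ} (h : φ ∈ testFunctions d) (e : Space d) :
    Integrable (fun x => f x * fderiv ℝ φ x e) volume := by
  have := hf.integrable_smul_right_of_hasCompactSupport
    ((h.1.continuous_fderiv one_ne_zero).clm_apply (continuous_const (y := e)))
    (h.2.fderiv_apply ℝ e)
  simpa using this

/-- The distributional partial derivative of `f` as a functional on test functions. -/
noncomputable def distribDeriv {d : ℕ} {f : Space d → ℝ} (hf : LocallyIntegrable f volume)
    (e : Space d) : testFunctions d →ₗ[ℝ] ℝ where
  toFun φ := -∫ x, f x * fderiv ℝ φ.1 x e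
  map_add' φ ψ := by
    rw [← neg_add, ← integral_add (integrable_mul_fderiv hf φ.2 e) (integrable_mul_fderiv hf ψ.2 e)]
    congr 2
    ext x
    have : fderiv ℝ (φ + ψ : testFunctions d).1 x = fderiv ℝ φ.1 x + fderiv ℝ ψ.1 x :=
      fderiv_add (φ.2.1.differentiable one_ne_zero x) (ψ.2.1.differentiable one_ne_zero x)
    rw [this, add_apply, mul_add]
  map_smul' c φ := by
    rw [RingHom.id_apply, smul_neg, ← integral_smul]
    congr 2
    ext x
    have : fderiv ℝ (c • φ : testFunctions d).1 x = c • fderiv ℝ φ.1 x :=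
      fderiv_const_smul (φ.2.1.differentiable one_ne_zero x) c
    rw [this, smul_apply, smul_eq_mul, smul_eq_mul]
    ring

/-- If the partial derivatives of `f` are represented by locally integrable densities, then `f` has
locally bounded variation. -/
theorem hasLocallyBoundedVariation_of_density {d : ℕ} {f : Space d → ℝ} {m : Measure (Space d)}
    {h : Fin d → Space d → ℝ} (hm : ∀ i, Measurable (h i)) (hl : ∀ i, LocallyIntegrable (h i) m)
    (hf : ∀ φ ∈ testFunctions d, ∀ i, -∫ x, f x * fderiv ℝ φ x (EuclideanSpace.single i 1) =
      ∫ x, φ x * h i x ∂m) : HasLocallyBoundedVariation f := by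
  set H : Space d → Space d := fun x => ∑ i, h i x • EuclideanSpace.single i (1 : ℝ) with hH
  have hHm : Measurable H := Finset.measurable_fun_sum _ fun i _ => (hm i).smul_const _
  have hHi : ∀ x i, H x i = h i x := by
    intro x i
    simp [hH, Pi.single_apply]
  have hHl : LocallyIntegrable H m := by
    have : ∀ i ∈ Finset.univ, LocallyIntegrable
        (fun x => h i x • EuclideanSpace.single i (1 : ℝ)) m := by
      intro i _ x
      obtain ⟨s, hs, hi⟩ := hl i x
      exact ⟨s, hs, hi.smul_const _⟩
    exact locallyIntegrable_finsetSum _ this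
  refine ⟨m.withDensity fun x => ‖H x‖ₑ, fun x => ‖H x‖⁻¹ • H x,
    isLocallyFiniteMeasure_withDensity_enorm hHl, hHm.norm.inv.smul hHm, ?_, ?_⟩
  · rw [ae_withDensity_iff hHm.enorm]
    refine Filter.Eventually.of_forall fun x hx => ?_
    have : ‖H x‖ ≠ 0 := by simpa using hx
    rw [norm_smul, norm_inv, norm_norm, inv_mul_cancel₀ this]
  · intro φ h1 h2 i
    rw [hf φ ⟨h1, h2⟩ i, integral_withDensity_eq_integral_toReal_smul hHm.enorm
      (Filter.Eventually.of_forall fun x => enorm_lt_top)]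
    refine integral_congr_ae (Filter.Eventually.of_forall fun x => ?_)
    simp only [toReal_enorm, smul_eq_mul, PiLp.smul_apply, hHi]
    by_cases hx : ‖H x‖ = 0
    · have : H x = 0 := norm_eq_zero.1 hx
      rw [← hHi x i, this]
      simp
    · field_simp

/-- Riesz representation: if the partial derivatives of `f` are dominated by a locally finite
measure, then `f` has locally bounded variation. -/
theorem hasLocallyBoundedVariation_of_derivLE {d : ℕ} {f : Space d → ℝ}
    (hf : LocallyIntegrable f volume) (μ : Measure (Space d)) [IsLocallyFiniteMeasure μ]
    (h : ∀ i, DerivLE f (EuclideanSpace.single i 1) μ) : HasLocallyBoundedVariation f := by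
  obtain ⟨w, hwm, hw0, hwi, hwb⟩ := exists_weight μ
  -- Since `w dm = dμ`, the derivative functional is bounded by `∫ |φ| w dm`, while `∫ w² dm = ∫ w
  -- dμ` is finite. Cauchy–Schwarz then makes the functional bounded for the `L^2(m)` norm.
  set m : Measure (Space d) := μ.withDensity fun x => ENNReal.ofReal (w x)⁻¹ with hm
  have hlf : IsLocallyFiniteMeasure m := by
    refine ⟨fun x => ⟨Metric.ball x 1, Metric.ball_mem_nhds x one_pos, ?_⟩⟩
    obtain ⟨C, hC⟩ := hwb (‖x‖ + 1)
    rw [hm, withDensity_apply _ Metric.isOpen_ball.measurableSet]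
    refine (setLIntegral_mono measurable_const (g := fun _ => ENNReal.ofReal C)
      fun y hy => ENNReal.ofReal_le_ofReal (hC y ?_)).trans_lt ?_
    · rw [Metric.mem_ball, dist_eq_norm] at hy
      have := norm_add_le x (y - x)
      rw [add_sub_cancel] at this
      linarith
    · rw [setLIntegral_const]
      exact ENNReal.mul_lt_top ENNReal.ofReal_lt_top
        ((measure_mono Metric.ball_subset_closedBall).trans_lt
          (isCompact_closedBall x 1).measure_lt_top)
  have hwe : Measurable fun x => ENNReal.ofReal (w x)⁻¹ := hwm.inv.ennreal_ofReal
  have hint : ∀ φ : Space d → ℝ, ∫ x, φ x ∂μ = ∫ x, φ x * w x ∂m := by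
    intro φ
    rw [hm, integral_withDensity_eq_integral_toReal_smul hwe
      (Filter.Eventually.of_forall fun x => ENNReal.ofReal_lt_top)]
    refine integral_congr_ae (Filter.Eventually.of_forall fun x => ?_)
    simp only [ENNReal.toReal_ofReal (inv_pos.2 (hw0 x)).le, smul_eq_mul]
    have := (hw0 x).ne'
    field_simp
  have hwL : MemLp w 2 m := by
    rw [memLp_two_iff_integrable_sq hwm.aestronglyMeasurable]
    refine ⟨(hwm.pow_const 2).aestronglyMeasurable, ?_⟩
    rw [hasFiniteIntegral_iff_ofReal (Filter.Eventually.of_forall fun x => sq_nonneg _), hm,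
      lintegral_withDensity_eq_lintegral_mul _ hwe
        (hwm.pow_const 2).ennreal_ofReal]
    convert hwi using 2 with x
    ext x
    simp only [Pi.mul_apply]
    rw [← ENNReal.ofReal_mul (inv_pos.2 (hw0 x)).le]
    congr 1
    have := (hw0 x).ne'
    field_simp
  have hbound : ∀ i (φ : testFunctions d), |distribDeriv hf (EuclideanSpace.single i 1) φ| ≤
      ‖hwL.toLp w‖ * ‖testFunctionsToL2 m φ‖ := by
    intro i φ
    have hφ : MemLp φ.1 2 m := memLp_of_mem_testFunctions φ.2
    have h1 : |distribDeriv hf (EuclideanSpace.single i 1) φ| ≤ ∫ x, |φ.1 x| * w x ∂m := by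
      rw [← hint]
      change |-∫ x, f x * fderiv ℝ φ.1 x (EuclideanSpace.single i 1)| ≤ _
      rw [abs_neg]
      exact h i φ.1 φ.2.1 φ.2.2
    have h2 : ∫ x, |φ.1 x| * w x ∂m = inner ℝ (hwL.toLp w) (hφ.norm.toLp _) := by
      rw [L2.inner_def]
      refine integral_congr_ae ?_
      filter_upwards [hwL.coeFn_toLp, hφ.norm.coeFn_toLp] with x e1 e2
      rw [e1, e2]
      simp
    have h3 : ‖hφ.norm.toLp _‖ = ‖testFunctionsToL2 m φ‖ := by
      change _ = ‖hφ.toLp _‖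
      rw [Lp.norm_toLp, Lp.norm_toLp, eLpNorm_norm]
    rw [h2] at h1
    refine h1.trans ((real_inner_le_norm _ _).trans_eq ?_)
    rw [h3]
  choose v hv using fun i => exists_forall_eq_inner_of_abs_le (testFunctionsToL2 m)
    (distribDeriv hf (EuclideanSpace.single i 1)) _ (hbound i)
  refine hasLocallyBoundedVariation_of_density (m := m) (h := fun i => v i)
    (fun i => (Lp.stronglyMeasurable (v i)).measurable)
    (fun i => (Lp.memLp (v i)).locallyIntegrable one_le_two) fun φ hφ i => ?_
  have h1 := hv i ⟨φ, hφ⟩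
  rw [L2.inner_def] at h1
  refine h1.trans (integral_congr_ae ?_)
  filter_upwards [(memLp_of_mem_testFunctions (m := m) hφ).coeFn_toLp] with x e1
  change inner ℝ (v i x) ((memLp_of_mem_testFunctions hφ).toLp φ x) = _
  rw [e1]
  simp

/-! ### Atoms of integer-valued measures -/

/-- Among the measurable subsets of `C` of positive mass take one, `C'`, of least mass: each
measurable subset of it is null or of full mass. Choosing the full side for each member of a
countable separating family leaves a set of full mass with only one point. -/
theorem exists_mem_measure_singleton_pos {α : Type*} [MeasurableSpace α]
    [MeasurableSpace.CountablySeparated α] {ν : Measure α}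
    (hν : ∀ U, MeasurableSet U → ∃ n : ℕ∞, ν U = (n : ℝ≥0∞)) {C : Set α} (hC : MeasurableSet C)
    (hC0 : 0 < ν C) (hCf : ν C < ∞) : ∃ a ∈ C, 0 < ν {a} := by
  classical
  have hnat : ∀ U, MeasurableSet U → ν U < ∞ → ∃ n : ℕ, ν U = n := by
    intro U hU hf
    obtain ⟨n, hn⟩ := hν U hU
    induction n with
    | top => simp [hn] at hf
    | coe n => exact ⟨n, by simpa using hn⟩
  have hex : ∃ k : ℕ, 0 < k ∧ ∃ C', C' ⊆ C ∧ MeasurableSet C' ∧ ν C' = k := by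
    obtain ⟨k, hk⟩ := hnat C hC hCf
    exact ⟨k, Nat.pos_of_ne_zero fun h => by simp [hk, h] at hC0, C, Subset.rfl, hC, hk⟩
  obtain ⟨hm0, C', hC'C, hC', hνC'⟩ := Nat.find_spec hex
  set m := Nat.find hex
  have hmin : ∀ D, D ⊆ C' → MeasurableSet D → ν D ≠ 0 → ν D = m := by
    intro D hD hDm hD0
    have hle : ν D ≤ ν C' := measure_mono hD
    obtain ⟨k, hk⟩ := hnat D hDm (hle.trans_lt (by simp [hνC']))
    have h1 : m ≤ k := Nat.find_min' hex
      ⟨Nat.pos_of_ne_zero fun h => hD0 (by simp [hk, h]), D, hD.trans hC'C, hDm, hk⟩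
    rw [hk, hνC'] at hle
    have h2 : k ≤ m := by exact_mod_cast hle
    rw [hk, le_antisymm h2 h1]
  obtain ⟨A, hA, hsep⟩ := exists_seq_separating α (p := MeasurableSet) MeasurableSet.empty univ
  -- The side of `A n` that carries the whole mass of `C'`.
  set t : ℕ → Set α := fun n => if ν (C' ∩ A n) = 0 then (A n)ᶜ else A n with ht
  have ht0 : ∀ n, ν (C' \ t n) = 0 := by
    intro n
    by_cases h : ν (C' ∩ A n) = 0
    · simp only [ht, h, if_true, sdiff_compl]
    · simp only [ht, h, if_false]
      have h1 := hmin _ inter_subset_left (hC'.inter (hA n)) h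
      have h2 := measure_inter_add_sdiff (μ := ν) C' (hA n)
      rw [h1, hνC'] at h2
      exact (ENNReal.add_right_inj (ENNReal.natCast_ne_top m)).1 (h2.trans (add_zero _).symm)
  have hD : ν (C' \ ⋂ n, t n) = 0 := by
    rw [sdiff_iInter]
    exact measure_iUnion_null ht0
  have hD' : ν (C' ∩ ⋂ n, t n) ≠ 0 := by
    intro h
    have h2 : ν C' ≤ ν (C' ∩ ⋂ n, t n) + ν (C' \ ⋂ n, t n) := measure_le_inter_add_sdiff _ _ _
    rw [h, hD, hνC', add_zero, nonpos_iff_eq_zero] at h2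
    exact hm0.ne' (by exact_mod_cast h2)
  obtain ⟨a, haC, hat⟩ := nonempty_of_measure_ne_zero hD'
  refine ⟨a, hC'C haC, (pos_iff_ne_zero.2 hD').trans_le (measure_mono ?_)⟩
  rintro b ⟨-, hb⟩
  refine hsep b (mem_univ _) a (mem_univ _) fun n => ?_
  have h1 := mem_iInter.1 hat n
  have h2 := mem_iInter.1 hb n
  by_cases h : ν (C' ∩ A n) = 0
  · simp only [ht, h, if_true] at h1 h2
    exact ⟨fun h' => absurd h' h2, fun h' => absurd h' h1⟩
  · simp only [ht, h, if_false] at h1 h2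
    exact ⟨fun _ => h1, fun _ => h2⟩

/-- Each atom has mass at least 1, and atoms are disjoint. -/
theorem finite_setOf_measure_singleton_pos {α : Type*} [MeasurableSpace α]
    [MeasurableSingletonClass α] {ν : Measure α}
    (hν : ∀ U, MeasurableSet U → ∃ n : ℕ∞, ν U = (n : ℝ≥0∞)) {U : Set α} (hU : MeasurableSet U)
    (hUf : ν U < ∞) : {a | a ∈ U ∧ 0 < ν {a}}.Finite := by
  have h := Measure.finite_const_le_meas_of_disjoint_iUnion (ι := α) ν (ε := 1) one_pos
    (As := fun a => {a} ∩ U) (fun a => (measurableSet_singleton a).inter hU) ?_ ?_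
  · refine h.subset ?_
    rintro a ⟨haU, ha⟩
    change 1 ≤ ν ({a} ∩ U)
    rw [inter_eq_left.2 (singleton_subset_iff.2 haU)]
    obtain ⟨n, hn⟩ := hν {a} (measurableSet_singleton a)
    rw [hn] at ha ⊢
    have : n ≠ 0 := by rintro rfl; simp at ha
    exact_mod_cast Order.one_le_iff_ne_zero.2 this
  · intro a b hab
    exact (disjoint_singleton.2 hab).mono inter_subset_left inter_subset_left
  · exact ((measure_mono (iUnion_subset fun a => inter_subset_right)).trans_lt hUf).ne

/-! ### Tent functions -/

/-- The function `x ↦ max (n - ‖x‖) 0`. -/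
noncomputable def tent (d n : ℕ) (x : Space d) : ℝ := max (n - ‖x‖) 0

theorem continuous_tent (d n : ℕ) : Continuous (tent d n) :=
  (continuous_const.sub continuous_norm).max continuous_const

theorem tent_nonneg {d n : ℕ} (x : Space d) : 0 ≤ tent d n x := le_max_right _ _

theorem tsupport_tent_subset (d n : ℕ) : tsupport (tent d n) ⊆ Metric.closedBall 0 n := by
  refine closure_minimal (fun x hx => ?_) Metric.isClosed_closedBall
  rw [mem_closedBall_zero_iff]
  by_contra h
  exact hx (max_eq_right (by linarith))

theorem hasCompactSupport_tent (d n : ℕ) : HasCompactSupport (tent d n) :=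
  (isCompact_closedBall _ _).of_isClosed_subset (isClosed_tsupport _) (tsupport_tent_subset d n)

theorem integrable_tent {d : ℕ} (n : ℕ) (μ : Measure (Space d)) [IsLocallyFiniteMeasure μ] :
    Integrable (tent d n) μ :=
  (continuous_tent d n).integrable_of_hasCompactSupport (hasCompactSupport_tent d n)

theorem one_le_tent {d n : ℕ} {r : ℝ} (h : r + 1 ≤ n) {x : Space d} (hx : ‖x‖ ≤ r) :
    1 ≤ tent d n x := le_max_of_le_left (by linarith)

theorem integral_tent_pos_of_measure_closedBall_pos {d n : ℕ} {μ : Measure (Space d)}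
    [IsLocallyFiniteMeasure μ] {r : ℝ} (h : r + 1 ≤ n) (hμ : 0 < μ (Metric.closedBall 0 r)) :
    0 < ∫ x, tent d n x ∂μ := by
  rw [integral_pos_iff_support_of_nonneg (fun x => tent_nonneg x) (integrable_tent n μ)]
  refine hμ.trans_le (measure_mono fun x hx => ?_)
  have := one_le_tent (d := d) h (mem_closedBall_zero_iff.1 hx)
  exact Function.mem_support.2 (by linarith)

theorem measure_closedBall_pos_of_integral_tent_pos {d n : ℕ} {μ : Measure (Space d)}
    (hμ : 0 < ∫ x, tent d n x ∂μ) : 0 < μ (Metric.closedBall 0 (n : ℝ)) := by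
  rw [pos_iff_ne_zero]
  intro h
  refine hμ.ne' (integral_eq_zero_of_ae ?_)
  have : ∀ᵐ x ∂μ, x ∉ Metric.closedBall (0 : Space d) (n : ℝ) := measure_eq_zero_iff_ae_notMem.1 h
  filter_upwards [this] with x hx
  exact image_eq_zero_of_notMem_tsupport fun h => hx (tsupport_tent_subset d n h)

/-! ### Properties of `FP` -/

theorem FP.hasLocallyBoundedVariation {d : ℕ} (A : FP d) : HasLocallyBoundedVariation A.ind := by
  obtain ⟨μ, σ, h, -⟩ := A.toBV.hasBoundedVariation
  exact ⟨μ, σ, h⟩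

theorem FP.isPolarDerivative {d : ℕ} (A : FP d) :
    ∃ σ, IsPolarDerivative A.ind (variationMeasure A.ind) σ := by
  obtain ⟨μ, σ, h⟩ := A.hasLocallyBoundedVariation
  exact ⟨σ, by rwa [h.variationMeasure_eq]⟩

instance {d : ℕ} (A : FP d) : IsLocallyFiniteMeasure (variationMeasure A.ind) :=
  A.hasLocallyBoundedVariation.isLocallyFiniteMeasure

theorem FP.integrable_ind {d : ℕ} (A : FP d) : Integrable A.ind volume :=
  L1.integrable_coeFn A.toBV.toLp

theorem FP.isInducing_toLp_variation (d : ℕ) :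
    IsInducing fun A : FP d => (A.toBV.toLp, A.toBV.variation) :=
  IsInducing.comp (g := fun f : BV d => (f.toLp, f.variation)) ⟨rfl⟩
    (f := FP.toBV) ⟨rfl⟩

theorem FP.toLp_injective (d : ℕ) : Function.Injective fun A : FP d => A.toBV.toLp := by
  rintro ⟨⟨f, hf⟩, h⟩ ⟨⟨g, hg⟩, h'⟩ e
  have e' : f = g := e
  subst e'
  rfl

theorem FP.ext_ind {d : ℕ} {A B : FP d} (h : A.ind =ᵐ[volume] B.ind) : A = B :=
  FP.toLp_injective d (Lp.ext h)

theorem FP.continuous_toLp (d : ℕ) : Continuous fun A : FP d => A.toBV.toLp :=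
  continuous_fst.comp (FP.isInducing_toLp_variation d).continuous

instance (d : ℕ) : SecondCountableTopology (FP d) :=
  have : Fact ((1 : ℝ≥0∞) ≠ ∞) := ⟨ENNReal.one_ne_top⟩
  (FP.isInducing_toLp_variation d).secondCountableTopology

instance (d : ℕ) : T2Space (FP d) :=
  T2Space.of_injective_continuous (FP.toLp_injective d) (FP.continuous_toLp d)

/-- The restriction of `1_A` to `K` as an element of `L^1(K)`. -/
noncomputable def FP.toLpOn {d : ℕ} (K : Set (Space d)) (A : FP d) :
    Lp ℝ 1 ((volume : Measure (Space d)).restrict K) :=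
  LpToLpRestrictCLM (Space d) ℝ ℝ volume 1 K A.toBV.toLp

theorem FP.continuous_toLpOn {d : ℕ} (K : Set (Space d)) :
    Continuous (FP.toLpOn K : FP d → _) :=
  (LpToLpRestrictCLM (Space d) ℝ ℝ volume 1 K).continuous.comp (FP.continuous_toLp d)

theorem FP.coeFn_toLpOn {d : ℕ} (K : Set (Space d)) (A : FP d) :
    A.toLpOn K =ᵐ[volume.restrict K] A.ind :=
  LpToLpRestrictCLM_coeFn ℝ K A.toBV.toLp

/-- The sets `A ∈ FP` whose perimeter charges the open ball of radius `n`. -/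
def hitting (d n : ℕ) : Set (FP d) := {A | 0 < ∫ x, tent d n x ∂(variationMeasure A.ind)}

/-- The set is open: the tent integral is lower semicontinuous in the class of the indicator in
`L^1` of the ball. -/
theorem measurableSet_hitting (d n : ℕ) : MeasurableSet (hitting d n) := by
  have h : hitting d n = (fun A : FP d => lpVariation _ (tent d n)
      (A.toLpOn (Metric.closedBall 0 n))) ⁻¹' Ioi 0 := by
    ext A
    rw [mem_preimage, ← A.hasLocallyBoundedVariation.ofReal_integral_eq_lpVariation
      (continuous_tent d n) (hasCompactSupport_tent d n) (fun x => tent_nonneg x)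
      (tsupport_tent_subset d n) (A.coeFn_toLpOn _), mem_Ioi, ENNReal.ofReal_pos]
    rfl
  rw [h]
  exact (((lowerSemicontinuous_lpVariation _ _).comp (FP.continuous_toLpOn _)).isOpen_preimage
    0).measurableSet

theorem isBoundedFamily_hitting (d n : ℕ) : IsBoundedFamily (hitting d n) :=
  ⟨measurableSet_hitting d n, Metric.closedBall 0 n, isCompact_closedBall _ _,
    fun _ hA => measure_closedBall_pos_of_integral_tent_pos hA⟩

theorem mem_hitting_of_measure_closedBall_pos {d n : ℕ} {A : FP d} {r : ℝ} (h : r + 1 ≤ n)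
    (hA : 0 < variationMeasure A.ind (Metric.closedBall 0 r)) : A ∈ hitting d n :=
  integral_tent_pos_of_measure_closedBall_pos h hA

/-- An integrable function whose derivative in some direction vanishes is zero. -/
theorem ae_eq_zero_of_derivLE_zero {d : ℕ} {f : Space d → ℝ} (hf : Integrable f volume)
    {e : Space d} (he : e ≠ 0) (h : DerivLE f e 0) : f =ᵐ[volume] 0 := by
  refine ae_eq_zero_of_integral_contDiff_smul_eq_zero hf.locallyIntegrable fun φ h1 h2 => ?_
  have h1' : ContDiff ℝ 1 φ := h1.of_le (by exact_mod_cast le_top)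
  -- A zero derivative bound makes the pairing with the translates of `φ` constant in `s`. As `s →
  -- ∞` the supports escape every fixed point, and dominated convergence, using integrability of
  -- `f`, makes the constant zero.
  have hconst : ∀ s : ℝ, 0 ≤ s → ∫ x, f x * φ (x - s • e) = ∫ x, f x * φ x := by
    intro s hs
    obtain ⟨C, hC⟩ := h1.continuous.bounded_above_of_compact_support h2
    have := h.abs_integral_comp_sub_sub_le hf.locallyIntegrable h1' h2 hs (ψ := fun _ => C)
      (integrable_zero_measure) fun t _ x => hC _
    rw [integral_zero_measure, mul_zero] at this
    exact sub_eq_zero.1 (abs_nonpos_iff.1 this)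
  obtain ⟨C, hC⟩ := h1.continuous.bounded_above_of_compact_support h2
  have hlim : Filter.Tendsto (fun n : ℕ => ∫ x, f x * φ (x - (n : ℝ) • e)) Filter.atTop
      (𝓝 (∫ x : Space d, (0 : ℝ))) := by
    refine tendsto_integral_of_dominated_convergence (fun x => ‖f x‖ * C) (fun n => ?_)
      (hf.norm.mul_const C) (fun n => ?_) ?_
    · exact hf.aestronglyMeasurable.mul
        (h1.continuous.comp (continuous_id.sub continuous_const)).aestronglyMeasurable
    · refine Filter.Eventually.of_forall fun x => ?_
      rw [norm_mul]
      exact mul_le_mul_of_nonneg_left (hC _) (norm_nonneg _)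
    · refine Filter.Eventually.of_forall fun x => ?_
      obtain ⟨r, hr⟩ := (IsCompact.isBounded h2).subset_closedBall (0 : Space d)
      refine tendsto_const_nhds.congr' ?_
      have he' : 0 < ‖e‖ := norm_pos_iff.2 he
      filter_upwards [Filter.eventually_gt_atTop ⌈(r + ‖x‖) / ‖e‖⌉₊] with n hn
      have hn' : r + ‖x‖ < n * ‖e‖ := by
        rw [← div_lt_iff₀ he']
        exact (Nat.le_ceil _).trans_lt (by exact_mod_cast hn)
      rw [image_eq_zero_of_notMem_tsupport (f := φ), mul_zero]
      intro hx
      have := mem_closedBall_zero_iff.1 (hr hx)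
      have h3 := norm_sub_norm_le ((n : ℝ) • e) x
      rw [norm_smul, Real.norm_of_nonneg (Nat.cast_nonneg n), norm_sub_rev] at h3
      linarith
  simp only [hconst _ (Nat.cast_nonneg _), integral_zero] at hlim
  have := tendsto_nhds_unique hlim tendsto_const_nhds
  simpa [mul_comm] using this.symm

/-- If no ball is charged, the variation vanishes and `A.ind` is an integrable function with zero
derivative in a coordinate direction. This is where `d ≥ 1` enters. -/
theorem FP.exists_mem_hitting {d : ℕ} (hd : 1 ≤ d) (A : FP d) (hA : ¬ A.ind =ᵐ[volume] 0) :
    ∃ n, A ∈ hitting d n := by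
  by_contra! h
  obtain ⟨σ, hσ⟩ := A.isPolarDerivative
  have h0 : variationMeasure A.ind = 0 := by
    rw [← Measure.measure_univ_eq_zero, ← Metric.iUnion_closedBall_nat (0 : Space d)]
    refine measure_iUnion_null fun n => ?_
    by_contra hn
    exact h (n + 1) (mem_hitting_of_measure_closedBall_pos (r := n) (by simp)
      (pos_iff_ne_zero.2 hn))
  have h1 := hσ.derivLE ⟨0, hd⟩
  rw [h0] at h1
  exact hA (ae_eq_zero_of_derivLE_zero A.integrable_ind (by simp) h1)

/-! ### The union set of a configuration and its perimeter. -/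

theorem HasLocallyBoundedVariation.congr {d : ℕ} {f g : Space d → ℝ}
    (h : HasLocallyBoundedVariation f) (hfg : f =ᵐ[volume] g) : HasLocallyBoundedVariation g := by
  obtain ⟨μ, σ, h⟩ := h
  exact ⟨μ, σ, h.congr hfg⟩

theorem hitting_mono {d : ℕ} {n k : ℕ} (h : n ≤ k) : hitting d n ⊆ hitting d k := by
  intro A hA
  refine lt_of_lt_of_le hA (integral_mono (integrable_tent n _) (integrable_tent k _) fun x => ?_)
  have : (n : ℝ) ≤ k := by exact_mod_cast h
  exact max_le_max (by linarith) le_rfl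

theorem FP.exists_measurableSet_rep {d : ℕ} (A : FP d) :
    ∃ S : Set (Space d), MeasurableSet S ∧ A.ind =ᵐ[volume] S.indicator 1 := by
  obtain ⟨S, hS, h⟩ := A.isIndicator
  obtain ⟨T, -, hT, hTS⟩ := hS.exists_measurable_superset_ae_eq
  exact ⟨T, hT, h.trans (indicator_ae_eq_of_ae_eq_set hTS.symm)⟩

/-- A Borel representative of `A ∈ FP`. -/
noncomputable def FP.rep {d : ℕ} (A : FP d) : Set (Space d) := A.exists_measurableSet_rep.choose

theorem FP.measurableSet_rep {d : ℕ} (A : FP d) : MeasurableSet A.rep :=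
  A.exists_measurableSet_rep.choose_spec.1

theorem FP.ind_ae_eq_rep {d : ℕ} (A : FP d) : A.ind =ᵐ[volume] A.rep.indicator 1 :=
  A.exists_measurableSet_rep.choose_spec.2

/-- The particles whose perimeter charges the open ball of radius `n`. -/
def Config.particlesHitting {d : ℕ} (ν : Config d) (n : ℕ) : Set (FP d) :=
  {A | A ∈ hitting d n ∧ 0 < ν.toMeasure {A}}

theorem Config.finite_particlesHitting {d : ℕ} (ν : Config d) (n : ℕ) :
    (ν.particlesHitting n).Finite :=
  finite_setOf_measure_singleton_pos ν.integer_valued (measurableSet_hitting d n)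
    (ν.finite_on_bounded _ (isBoundedFamily_hitting d n))

/-- The particles which are not null sets. -/
def Config.particles {d : ℕ} (ν : Config d) : Set (FP d) := ⋃ n, ν.particlesHitting n

theorem Config.countable_particles {d : ℕ} (ν : Config d) : ν.particles.Countable :=
  countable_iUnion fun n => (ν.finite_particlesHitting n).countable

instance {d : ℕ} (ν : Config d) : Countable ν.particles := ν.countable_particles

/-- The union of Borel representatives of the particles. -/
noncomputable def Config.unionSet {d : ℕ} (ν : Config d) : Set (Space d) :=
  ⋃ A : ν.particles, A.1.rep

theorem Config.measurableSet_unionSet {d : ℕ} (ν : Config d) : MeasurableSet ν.unionSet :=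
  MeasurableSet.iUnion fun A => A.1.measurableSet_rep

/-- Only finitely many particles charge a given ball, so the sum is locally a finite sum of locally
finite measures. -/
theorem Config.isLocallyFiniteMeasure_sum {d : ℕ} (ν : Config d) :
    IsLocallyFiniteMeasure (Measure.sum fun A : ν.particles => variationMeasure A.1.ind) := by
  refine ⟨fun x => ⟨Metric.closedBall 0 (‖x‖ + 1), ?_, ?_⟩⟩
  · refine Filter.mem_of_superset (Metric.ball_mem_nhds x one_pos) fun y hy => ?_
    rw [Metric.mem_ball, dist_eq_norm] at hy
    rw [mem_closedBall_zero_iff]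
    have := norm_add_le x (y - x)
    rw [add_sub_cancel] at this
    linarith
  · rw [Measure.sum_apply _ Metric.isClosed_closedBall.measurableSet]
    -- One unit beyond the ball, since the tent of height `n` is at least 1 only on the ball of
    -- radius `n - 1`.
    set n := ⌈‖x‖ + 1 + 1⌉₊
    have hfin : {A : ν.particles | A.1 ∈ ν.particlesHitting n}.Finite :=
      (ν.finite_particlesHitting n).preimage Subtype.val_injective.injOn
    rw [tsum_eq_sum (s := hfin.toFinset)]
    · exact ENNReal.sum_lt_top.2 fun A _ => (isCompact_closedBall _ _).measure_lt_top
    · intro A hA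
      by_contra h
      refine hA (hfin.mem_toFinset.2 ⟨mem_hitting_of_measure_closedBall_pos (Nat.le_ceil _)
        (pos_iff_ne_zero.2 h), ?_⟩)
      obtain ⟨k, hk⟩ := mem_iUnion.1 A.2
      exact hk.2

theorem Config.hasLocallyBoundedVariation_unionSet {d : ℕ} (ν : Config d) :
    HasLocallyBoundedVariation (ν.unionSet.indicator (1 : Space d → ℝ)) := by
  have := ν.isLocallyFiniteMeasure_sum
  refine hasLocallyBoundedVariation_of_derivLE
    (locallyIntegrable_indicator_one ν.measurableSet_unionSet) _ fun i =>
    DerivLE.iUnion (μ := fun A : ν.particles => variationMeasure A.1.ind)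
      (fun A => A.1.measurableSet_rep) fun A => ?_
  obtain ⟨σ, hσ⟩ := A.1.isPolarDerivative
  exact (hσ.derivLE i).congr A.1.ind_ae_eq_rep

/-- The union of the particles, as an element of `FP_loc`. -/
noncomputable def Config.union {d : ℕ} (ν : Config d) : FPloc d where
  toBVloc :=
    { toAEEqFun := AEEqFun.mk (ν.unionSet.indicator (1 : Space d → ℝ))
        (locallyIntegrable_indicator_one ν.measurableSet_unionSet).aestronglyMeasurable
      locallyIntegrable := (locallyIntegrable_indicator_one ν.measurableSet_unionSet).congr
        (AEEqFun.coeFn_mk _ _).symm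
      hasLocallyBoundedVariation := ν.hasLocallyBoundedVariation_unionSet.congr
        (AEEqFun.coeFn_mk _ _).symm }
  isIndicator := ⟨ν.unionSet, ν.measurableSet_unionSet.nullMeasurableSet, AEEqFun.coeFn_mk _ _⟩

theorem Config.union_ind {d : ℕ} (ν : Config d) :
    ν.union.ind =ᵐ[volume] ν.unionSet.indicator 1 := AEEqFun.coeFn_mk _ _

/-- An atom that hits no ball is the class of null sets, which contributes nothing to the union.
Hence there are countably many atoms, and the exceptional null sets of all representatives can be
discarded together. -/
theorem Config.isUnionOf_union {d : ℕ} (hd : 1 ≤ d) (ν : Config d) : IsUnionOf ν.union ν := by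
  intro r hr
  refine ν.union_ind.trans ?_
  set T : Set (FP d) := {A | 0 < ν.toMeasure {A}} with hT
  have hT1 : ∀ A ∈ T, A ∈ ν.particles ∨ A.ind =ᵐ[volume] 0 := by
    intro A hA
    by_cases h : A.ind =ᵐ[volume] 0
    · exact Or.inr h
    · obtain ⟨n, hn⟩ := A.exists_mem_hitting hd h
      exact Or.inl (mem_iUnion.2 ⟨n, hn, hA⟩)
  -- The particles hitting some ball are countable, and the null sets form a single point of `FP`.
  have hTc : T.Countable := by
    have hs : {A : FP d | A.ind =ᵐ[volume] 0}.Subsingleton := fun A hA B hB =>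
      FP.ext_ind (Filter.EventuallyEq.trans hA (Filter.EventuallyEq.symm hB))
    exact (ν.countable_particles.union hs.countable).mono hT1
  have h1 : ∀ᵐ x, ∀ A ∈ T, A.ind x = (r A).indicator 1 x :=
    (ae_ball_iff hTc).2 fun A _ => hr A
  have h2 : ∀ᵐ x, ∀ A ∈ T, A.ind x = A.rep.indicator 1 x :=
    (ae_ball_iff hTc).2 fun A _ => A.ind_ae_eq_rep
  have h3 : ∀ᵐ x, ∀ A ∈ T, A ∉ ν.particles → A.ind x = 0 :=
    (ae_ball_iff hTc).2 fun A hA => by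
      rcases hT1 A hA with h | h
      · exact Filter.Eventually.of_forall fun x h' => absurd h h'
      · filter_upwards [h] with x hx _ using hx
  filter_upwards [h1, h2, h3] with x e1 e2 e3
  have hiff : x ∈ ν.unionSet ↔ x ∈ ⋃ A ∈ T, r A := by
    simp only [Config.unionSet, mem_iUnion, Subtype.exists, exists_prop]
    constructor
    · rintro ⟨A, hA, hx⟩
      have hAT : A ∈ T := by
        obtain ⟨k, hk⟩ := mem_iUnion.1 hA
        exact hk.2
      refine ⟨A, hAT, ?_⟩
      by_contra h
      have := (e1 A hAT).symm.trans (e2 A hAT)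
      simp [h, hx] at this
    · rintro ⟨A, hAT, hx⟩
      have h4 : A.ind x = 1 := by rw [e1 A hAT, indicator_of_mem hx, Pi.one_apply]
      have hA : A ∈ ν.particles := by
        by_contra h
        rw [e3 A hAT h] at h4
        exact zero_ne_one h4
      refine ⟨A, hA, ?_⟩
      by_contra h
      rw [e2 A hAT, indicator_of_notMem h] at h4
      exact zero_ne_one h4
  by_cases hx : x ∈ ν.unionSet
  · rw [indicator_of_mem hx, indicator_of_mem (hiff.1 hx)]
  · rw [indicator_of_notMem hx, indicator_of_notMem fun h => hx (hiff.2 h)]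

/-! ### Translations -/

theorem FP.translate_ind {d : ℕ} (z : Space d) (A : FP d) :
    (A.translate z).ind =ᵐ[volume] fun x => A.ind (x - z) :=
  Lp.coeFn_compMeasurePreserving A.toBV.toLp (measurePreserving_sub z)

theorem FPloc.translate_ind {d : ℕ} (z : Space d) (A : FPloc d) :
    (A.translate z).ind =ᵐ[volume] fun x => A.ind (x - z) :=
  AEEqFun.coeFn_compMeasurePreserving A.toBVloc.toAEEqFun (measurePreserving_sub z)

theorem FPloc.ext_ind {d : ℕ} {A B : FPloc d} (h : A.ind =ᵐ[volume] B.ind) : A = B := by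
  obtain ⟨⟨f, hf, hf'⟩, h1⟩ := A
  obtain ⟨⟨g, hg, hg'⟩, h2⟩ := B
  have e : f = g := AEEqFun.ext h
  subst e
  rfl

theorem FP.translate_translate {d : ℕ} (z w : Space d) (A : FP d) :
    (A.translate w).translate z = A.translate (w + z) := by
  refine FP.ext_ind ((FP.translate_ind z _).trans (Filter.EventuallyEq.trans ?_
    (FP.translate_ind (w + z) A).symm))
  have := (measurePreserving_sub z).quasiMeasurePreserving.ae_eq_comp (FP.translate_ind w A)
  filter_upwards [this] with x hx
  simp only [Function.comp] at hx
  rw [hx]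
  congr 1
  abel

theorem FP.translate_zero {d : ℕ} (A : FP d) : A.translate 0 = A :=
  FP.ext_ind ((FP.translate_ind 0 A).trans (by simp))

theorem FP.preimage_translate_singleton {d : ℕ} (z : Space d) (A : FP d) :
    FP.translate z ⁻¹' {A} = {A.translate (-z)} := by
  ext B
  rw [mem_preimage, mem_singleton_iff, mem_singleton_iff]
  constructor
  · rintro rfl
    rw [FP.translate_translate, add_neg_cancel, FP.translate_zero]
  · rintro rfl
    rw [FP.translate_translate, neg_add_cancel, FP.translate_zero]

theorem Config.shift_singleton {d : ℕ} (z : Space d) (ν : Config d) (A : FP d) :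
    (ν.shift z).toMeasure {A} = ν.toMeasure {A.translate (-z)} := by
  change (ν.toMeasure.map (FP.translate z)) {A} = _
  rw [Measure.map_apply (FP.measurable_translate z) (measurableSet_singleton A),
    FP.preimage_translate_singleton]

/-- The union does not depend on the representatives, so those of the shifted particles may be taken
to be translates of the given ones; then the two unions agree as sets. -/
theorem Config.union_shift {d : ℕ} (hd : 1 ≤ d) (z : Space d) (ν : Config d) :
    (ν.shift z).union = ν.union.translate z := by
  refine FPloc.ext_ind ?_
  have h1 := (ν.shift z).isUnionOf_union hd
    (fun B => (fun x => x - z) ⁻¹' (B.translate (-z)).rep) fun B => ?_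
  · refine h1.trans (Filter.EventuallyEq.symm ((FPloc.translate_ind z _).trans ?_))
    have h2 := (measurePreserving_sub z).quasiMeasurePreserving.ae_eq_comp
      (ν.isUnionOf_union hd FP.rep FP.ind_ae_eq_rep)
    refine h2.trans (Filter.EventuallyEq.of_eq ?_)
    have e : (⋃ A ∈ {A : FP d | 0 < (ν.shift z).toMeasure {A}},
        (fun x => x - z) ⁻¹' (A.translate (-z)).rep) =
        (fun x => x - z) ⁻¹' (⋃ A ∈ {A : FP d | 0 < ν.toMeasure {A}}, A.rep) := by
      ext x
      simp only [mem_iUnion, mem_preimage, mem_ofPred_eq, Config.shift_singleton, exists_prop]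
      constructor
      · rintro ⟨A, hA, hx⟩
        exact ⟨_, hA, hx⟩
      · rintro ⟨A, hA, hx⟩
        refine ⟨A.translate z, ?_⟩
        rw [FP.translate_translate, add_neg_cancel, FP.translate_zero]
        exact ⟨hA, hx⟩
    rw [e]
    rfl
  · have h3 : B.ind = ((B.translate (-z)).translate z).ind := by
      rw [FP.translate_translate, neg_add_cancel, FP.translate_zero]
    rw [h3]
    refine (FP.translate_ind z _).trans ?_
    exact (measurePreserving_sub z).quasiMeasurePreserving.ae_eq_comp
      (B.translate (-z)).ind_ae_eq_rep

theorem Config.measurable_measure {d : ℕ} {U : Set (FP d)} (hU : IsBoundedFamily U) :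
    Measurable fun ν : Config d => ν.toMeasure U :=
  (comap_measurable _).mono (le_iSup (fun V : {U : Set (FP d) // IsBoundedFamily U} =>
    MeasurableSpace.comap (fun ν : Config d => ν.toMeasure V.1) inferInstance) ⟨U, hU⟩) le_rfl

theorem Config.measurable_of_measurable_measure {d : ℕ} {Ω : Type*} [MeasurableSpace Ω]
    {f : Ω → Config d} (h : ∀ U, IsBoundedFamily U → Measurable fun ω => (f ω).toMeasure U) :
    Measurable f := by
  refine measurable_iff_comap_le.2 ?_
  unfold instMeasurableSpaceConfig
  rw [MeasurableSpace.comap_iSup]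
  refine iSup_le fun U => ?_
  rw [MeasurableSpace.comap_comp]
  exact measurable_iff_comap_le.1 (h U.1 U.2)

theorem Config.measurable_shift {d : ℕ} (z : Space d) :
    Measurable (Config.shift z : Config d → Config d) := by
  refine Config.measurable_of_measurable_measure fun U hU => ?_
  have h : (fun ν : Config d => (ν.shift z).toMeasure U) =
      fun ν => ν.toMeasure (FP.translate z ⁻¹' U) := by
    ext ν
    exact Measure.map_apply (FP.measurable_translate z) hU.1
  rw [h]
  exact Config.measurable_measure (hU.preimage_translate z)

/-! ### The topology of `BV_loc` is generated by countably many functions -/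

/-- The closed ball of radius `n` as a bundled compact set. -/
def compactBall (d n : ℕ) : TopologicalSpace.Compacts (Space d) :=
  ⟨Metric.closedBall 0 n, isCompact_closedBall _ _⟩

theorem BVloc.coeFn_restrict {d : ℕ} (K : TopologicalSpace.Compacts (Space d)) (f : BVloc d) :
    f.restrict K =ᵐ[volume.restrict (K : Set (Space d))] f.toAEEqFun :=
  Integrable.coeFn_toL1 _

/-- The integral of `g` against the variation measure of `f`. -/
noncomputable def BVloc.integralVariation {d : ℕ} (g : Space d → ℝ) (f : BVloc d) : ℝ :=
  ∫ x, g x ∂(variationMeasure (f.toAEEqFun : Space d → ℝ))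

theorem BVloc.edist_restrict_le {d : ℕ} {K K' : TopologicalSpace.Compacts (Space d)}
    (h : (K : Set (Space d)) ⊆ K') (f g : BVloc d) :
    edist (f.restrict K) (g.restrict K) ≤ edist (f.restrict K') (g.restrict K') := by
  have e : ∀ K : TopologicalSpace.Compacts (Space d), edist (f.restrict K) (g.restrict K) =
      ∫⁻ x in (K : Set (Space d)), edist (f.toAEEqFun x) (g.toAEEqFun x) := fun K =>
    Integrable.edist_toL1_toL1 _ _ _ _
  rw [e, e]
  exact lintegral_mono_set h

theorem exists_tsupport_subset_closedBall_nat {d : ℕ} {g : Space d → ℝ} (h : HasCompactSupport g) :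
    ∃ n : ℕ, tsupport g ⊆ Metric.closedBall 0 n := by
  obtain ⟨r, hr⟩ := (IsCompact.isBounded h).subset_closedBall (0 : Space d)
  exact ⟨⌈r⌉₊, hr.trans (Metric.closedBall_subset_closedBall (Nat.le_ceil r))⟩

section Continuity

variable {d : ℕ} {Z : Type*} [TopologicalSpace Z] {X : Z → BVloc d}

theorem BVloc.eventually_lt_integralVariation
    (h1 : ∀ n, Continuous fun z => (X z).restrict (compactBall d n))
    {g : Space d → ℝ} (hg : Continuous g) (hgs : HasCompactSupport g) (g0 : ∀ x, 0 ≤ g x)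
    {z : Z} {c : ℝ} (hc : c < (X z).integralVariation g) :
    ∀ᶠ z' in 𝓝 z, c < (X z').integralVariation g := by
  obtain ⟨n, hn⟩ := exists_tsupport_subset_closedBall_nat hgs
  have hV : ∀ z, ENNReal.ofReal ((X z).integralVariation g) =
      lpVariation _ g ((X z).restrict (compactBall d n)) := fun z =>
    (X z).hasLocallyBoundedVariation.ofReal_integral_eq_lpVariation hg hgs g0 hn
      (BVloc.coeFn_restrict _ _)
  have hV0 : ∀ z, 0 ≤ (X z).integralVariation g := fun z => integral_nonneg g0
  rcases lt_or_ge c 0 with hc0 | hc0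
  · exact Filter.Eventually.of_forall fun z' => hc0.trans_le (hV0 z')
  · have hl := (lowerSemicontinuous_lpVariation _ g).comp (h1 n)
    have h3 : ENNReal.ofReal c < lpVariation _ g ((X z).restrict (compactBall d n)) := by
      rw [← hV]
      exact (ENNReal.ofReal_lt_ofReal_iff (hc0.trans_lt hc)).2 hc
    filter_upwards [hl z _ h3] with z' hz'
    simp only [Function.comp] at hz'
    rw [← hV] at hz'
    exact (ENNReal.ofReal_lt_ofReal_iff_of_nonneg hc0).1 hz'

/-- Both `g` and `M t - g` are nonnegative, so their integrals are lower semicontinuous. Their sum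
is continuous by assumption on the tent `t`, hence each is continuous. -/
theorem BVloc.continuous_integralVariation
    (h1 : ∀ n, Continuous fun z => (X z).restrict (compactBall d n))
    (h2 : ∀ n, Continuous fun z => (X z).integralVariation (tent d n))
    {g : Space d → ℝ} (hg : Continuous g) (hgs : HasCompactSupport g) (g0 : ∀ x, 0 ≤ g x) :
    Continuous fun z => (X z).integralVariation g := by
  obtain ⟨n, hn⟩ := exists_tsupport_subset_closedBall_nat hgs
  obtain ⟨M, hM⟩ := hg.bounded_above_of_compact_support hgs
  have hM0 : 0 ≤ M := (norm_nonneg _).trans (hM 0)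
  -- Index `n + 1` makes the tent at least 1 on the ball of radius `n`, which contains the support
  -- of `g`.
  set t : Space d → ℝ := tent d (n + 1) with ht
  set k : Space d → ℝ := fun x => M * t x - g x with hk
  have htc : Continuous fun x => M * t x := continuous_const.mul (continuous_tent d (n + 1))
  have hts : HasCompactSupport fun x => M * t x := (hasCompactSupport_tent d (n + 1)).mul_left
  have hkc : Continuous k := htc.sub hg
  have hks : HasCompactSupport k := hts.sub hgs
  have hk0 : ∀ x, 0 ≤ k x := by
    intro x
    by_cases hx : x ∈ tsupport g
    · have h3 : 1 ≤ t x := one_le_tent (r := n) (by simp) (mem_closedBall_zero_iff.1 (hn hx))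
      have h4 := (Real.le_norm_self _).trans (hM x)
      simp only [hk]
      nlinarith
    · simp only [hk, image_eq_zero_of_notMem_tsupport hx, sub_zero]
      exact mul_nonneg hM0 (tent_nonneg x)
  have hsum : ∀ z, (X z).integralVariation k =
      M * (X z).integralVariation t - (X z).integralVariation g := by
    intro z
    have := (X z).hasLocallyBoundedVariation.isLocallyFiniteMeasure
    unfold BVloc.integralVariation
    rw [← integral_const_mul, ← integral_sub (htc.integrable_of_hasCompactSupport hts)
      (hg.integrable_of_hasCompactSupport hgs)]
  refine continuous_iff_continuousAt.2 fun z => tendsto_order.2 ⟨fun c hc => ?_, fun c hc => ?_⟩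
  · exact BVloc.eventually_lt_integralVariation h1 hg hgs g0 hc
  · have hlt : M * (X z).integralVariation t - c < (X z).integralVariation k := by
      rw [hsum]
      linarith
    obtain ⟨b, hb1, hb2⟩ := exists_between hlt
    have h5 : ∀ᶠ z' in 𝓝 z, M * (X z').integralVariation t - c < b :=
      (((continuous_const.mul (h2 (n + 1))).sub continuous_const).tendsto z).eventually
        (gt_mem_nhds hb1)
    filter_upwards [h5, BVloc.eventually_lt_integralVariation h1 hkc hks hk0 hb2] with z' h6 h7
    rw [hsum] at h7
    linarith

/-- A map to `BV_loc` is continuous if its restrictions to the balls and the integrals of the tent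
functions against the variation measures are continuous. -/
theorem BVloc.continuous_of_tent
    (h1 : ∀ n, Continuous fun z => (X z).restrict (compactBall d n))
    (h2 : ∀ n, Continuous fun z => (X z).integralVariation (tent d n)) : Continuous X := by
  refine continuous_inf_rng.2 ⟨continuous_iInf_rng.2 fun K => continuous_induced_rng.2 ?_,
    continuous_iInf_rng.2 fun g => continuous_induced_rng.2 ?_⟩
  · obtain ⟨r, hr⟩ := K.isCompact.isBounded.subset_closedBall (0 : Space d)
    have hK : (K : Set (Space d)) ⊆ compactBall d ⌈r⌉₊ :=
      hr.trans (Metric.closedBall_subset_closedBall (Nat.le_ceil r))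
    refine continuous_iff_continuousAt.2 fun z => tendsto_iff_edist_tendsto_0.2 ?_
    have h3 := tendsto_iff_edist_tendsto_0.1 ((h1 ⌈r⌉₊).tendsto z)
    exact tendsto_of_tendsto_of_tendsto_of_le_of_le tendsto_const_nhds h3 (fun _ => zero_le)
      fun z' => BVloc.edist_restrict_le hK _ _
  · have hg := g.continuous
    have hgs : HasCompactSupport g := g.hasCompactSupport
    have c1 : Continuous fun x => max (g x) 0 := hg.max continuous_const
    have c2 : Continuous fun x => max (-g x) 0 := hg.neg.max continuous_const
    have s1 : HasCompactSupport fun x => max (g x) 0 :=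
      hgs.comp_left (g := fun t : ℝ => max t 0) (by simp)
    have s2 : HasCompactSupport fun x => max (-g x) 0 :=
      hgs.comp_left (g := fun t : ℝ => max (-t) 0) (by simp)
    have e : (fun z => (X z).integralVariation g) = fun z =>
        (X z).integralVariation (fun x => max (g x) 0) -
          (X z).integralVariation fun x => max (-g x) 0 := by
      ext z
      have := (X z).hasLocallyBoundedVariation.isLocallyFiniteMeasure
      unfold BVloc.integralVariation
      rw [← integral_sub (c1.integrable_of_hasCompactSupport s1)
        (c2.integrable_of_hasCompactSupport s2)]
      exact integral_congr_ae (Filter.Eventually.of_forall fun x =>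
        (max_zero_sub_eq_self (g x)).symm)
    change Continuous fun z => (X z).integralVariation g
    rw [e]
    exact (BVloc.continuous_integralVariation h1 h2 c1 s1 fun x => le_max_right _ _).sub
      (BVloc.continuous_integralVariation h1 h2 c2 s2 fun x => le_max_right _ _)

end Continuity

/-! ### Measurability of maps into `FP_loc`. -/

noncomputable instance instMeasurableSpaceLpOne {α : Type*} [MeasurableSpace α] (m : Measure α) :
    MeasurableSpace (Lp ℝ 1 m) := borel _

instance instBorelSpaceLpOne {α : Type*} [MeasurableSpace α] (m : Measure α) :
    BorelSpace (Lp ℝ 1 m) := ⟨rfl⟩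

instance instSecondCountableTopologyLpOneRestrict {d : ℕ} (K : Set (Space d)) :
    SecondCountableTopology (Lp ℝ 1 ((volume : Measure (Space d)).restrict K)) :=
  have : Fact ((1 : ℝ≥0∞) ≠ ∞) := ⟨ENNReal.one_ne_top⟩
  inferInstance

/-- A map to `FP_loc` is measurable if its restrictions to the balls are. -/
theorem FPloc.measurable_of_restrict {d : ℕ} {Ω : Type*} [MeasurableSpace Ω] {X : Ω → FPloc d}
    (h : ∀ n, Measurable fun ω => (X ω).toBVloc.restrict (compactBall d n)) : Measurable X := by
  -- Countably many coordinates in second countable spaces: on the target the product and Borel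
  -- `σ`-algebras agree, and every open set of `FP_loc` is the preimage of an open set under `Ψ`.
  let Ψ : FPloc d → (n : ℕ) →
      Lp ℝ 1 ((volume : Measure (Space d)).restrict (compactBall d n)) × ℝ := fun A n =>
    (A.toBVloc.restrict (compactBall d n), A.toBVloc.integralVariation (tent d n))
  have hΨc : @Continuous _ _ (TopologicalSpace.induced Ψ inferInstance) _ Ψ :=
    continuous_induced_dom
  have hle : TopologicalSpace.induced Ψ inferInstance ≤
      TopologicalSpace.induced FPloc.toBVloc inferInstance := by
    refine continuous_iff_le_induced.1 (@BVloc.continuous_of_tent d (FPloc d)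
      (TopologicalSpace.induced Ψ inferInstance) FPloc.toBVloc (fun n => ?_) fun n => ?_)
    · exact @Continuous.comp _ _ _ (TopologicalSpace.induced Ψ inferInstance) _ _ _ _
        (continuous_fst.comp (continuous_apply n)) hΨc
    · exact @Continuous.comp _ _ _ (TopologicalSpace.induced Ψ inferInstance) _ _ _ _
        (continuous_snd.comp (continuous_apply n)) hΨc
  -- The tent integrals need no hypothesis of their own: they are lower semicontinuous functions of
  -- the restrictions.
  have hint : ∀ n, Measurable fun ω => (X ω).toBVloc.integralVariation (tent d n) := by
    intro n
    have e : (fun ω => (X ω).toBVloc.integralVariation (tent d n)) = fun ω =>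
        (lpVariation _ (tent d n) ((X ω).toBVloc.restrict (compactBall d n))).toReal := by
      ext ω
      have h5 := (X ω).toBVloc.hasLocallyBoundedVariation.ofReal_integral_eq_lpVariation
        (continuous_tent d n) (hasCompactSupport_tent d n) (fun x => tent_nonneg x)
        (tsupport_tent_subset d n) (BVloc.coeFn_restrict (compactBall d n) _)
      exact ((congrArg ENNReal.toReal h5).symm.trans
        (ENNReal.toReal_ofReal (integral_nonneg fun x => tent_nonneg x))).symm
    rw [e]
    exact ((lowerSemicontinuous_lpVariation _ _).measurable.comp (h n)).ennreal_toReal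
  have hm : Measurable fun ω => Ψ (X ω) :=
    measurable_pi_iff.2 fun n => (h n).prodMk (hint n)
  refine measurable_of_isOpen fun U hU => ?_
  obtain ⟨V, hV, rfl⟩ := isOpen_induced_iff.1 (hle U hU)
  exact hm hV.measurableSet

/-! ### Finite suprema -/

/-- The supremum of `0` and the values of `f` on a finite set. -/
noncomputable def supZero {ι L : Type*} [SemilatticeSup L] [Zero L] (s : Finset ι) (f : ι → L) :
    L := s.fold (· ⊔ ·) 0 f

section supZero

variable {ι L : Type*} [SemilatticeSup L] [Zero L]

theorem supZero_empty (f : ι → L) : supZero ∅ f = 0 := Finset.fold_empty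

theorem supZero_insert [DecidableEq ι] {a : ι} {s : Finset ι} (h : a ∉ s) (f : ι → L) :
    supZero (insert a s) f = f a ⊔ supZero s f := Finset.fold_insert h

theorem supZero_le_iff {s : Finset ι} {f : ι → L} {c : L} :
    supZero s f ≤ c ↔ 0 ≤ c ∧ ∀ i ∈ s, f i ≤ c := by
  classical
  induction s using Finset.induction_on with
  | empty => simp [supZero_empty]
  | insert a s ha ih =>
    rw [supZero_insert ha, sup_le_iff, ih, Finset.forall_mem_insert]
    tauto

theorem measurable_supZero {Ω : Type*} [MeasurableSpace Ω] [MeasurableSpace L] [MeasurableSup₂ L]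
    {s : Finset ι} {f : Ω → ι → L} (h : ∀ i, Measurable fun ω => f ω i) :
    Measurable fun ω => supZero s (f ω) := by
  classical
  induction s using Finset.induction_on with
  | empty => simp only [supZero_empty, measurable_const]
  | insert a s ha ih =>
    simp only [supZero_insert ha]
    exact (h a).sup ih

theorem tendsto_supZero [TopologicalSpace L] [ContinuousSup L] {s : Finset ι} {f : ℕ → ι → L}
    {g : ι → L} (h : ∀ i, Filter.Tendsto (fun k => f k i) Filter.atTop (𝓝 (g i))) :
    Filter.Tendsto (fun k => supZero s (f k)) Filter.atTop (𝓝 (supZero s g)) := by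
  classical
  induction s using Finset.induction_on with
  | empty => simp only [supZero_empty, tendsto_const_nhds]
  | insert a s ha ih =>
    simp only [supZero_insert ha]
    exact (h a).sup_nhds ih

end supZero

/-! ### Measurability of the union. -/

/-- The union of the particles hitting the ball of radius `n`, as an element of `L^1(K)`. -/
noncomputable def Config.finiteUnionOn {d : ℕ} (K : Set (Space d)) (n : ℕ) (ν : Config d) :
    Lp ℝ 1 ((volume : Measure (Space d)).restrict K) :=
  supZero (ν.finite_particlesHitting n).toFinset (FP.toLpOn K)

/-- Approximate the embedding into `L^1(K)` pointwise by simple functions `c k`. The supremum of `c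
k` over the hitting particles is determined by which of its finitely many values are attained there,
and that is visible from masses of bounded families. -/
theorem Config.measurable_finiteUnionOn {d : ℕ} (K : Set (Space d)) (n : ℕ) :
    Measurable (Config.finiteUnionOn K n : Config d → _) := by
  classical
  have hm : Measurable (FP.toLpOn K : FP d → _) := (FP.continuous_toLpOn K).measurable
  let c : ℕ → SimpleFunc (FP d) (Lp ℝ 1 ((volume : Measure (Space d)).restrict K)) := fun k =>
    SimpleFunc.approxOn (FP.toLpOn K) hm univ 0 (mem_univ _) k
  have hc : ∀ A, Filter.Tendsto (fun k => c k A) Filter.atTop (𝓝 (A.toLpOn K)) := fun A =>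
    SimpleFunc.tendsto_approxOn hm (mem_univ _) (by simp)
  have hbdd : ∀ k v, IsBoundedFamily (c k ⁻¹' {v} ∩ hitting d n) := by
    intro k v
    obtain ⟨h1, C, hC, h2⟩ := isBoundedFamily_hitting d n
    exact ⟨((c k).measurableSet_preimage _).inter h1, C, hC, fun A hA => h2 A hA.2⟩
  let F : ℕ → Config d → Lp ℝ 1 ((volume : Measure (Space d)).restrict K) := fun k ν =>
    supZero (c k).range fun v =>
      -- The value 0 for unattained `v` is harmless, since `supZero` already includes 0.
      if 0 < ν.toMeasure (c k ⁻¹' {v} ∩ hitting d n) then v else 0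
  have hF : ∀ k, Measurable (F k) := by
    intro k
    refine measurable_supZero fun v => Measurable.ite ?_ measurable_const measurable_const
    exact measurableSet_lt measurable_const (Config.measurable_measure (hbdd k v))
  have hFeq : ∀ k ν, F k ν = supZero (ν.finite_particlesHitting n).toFinset (c k) := by
    intro k ν
    have h0 := supZero_le_iff.1 (le_refl (supZero (ν.finite_particlesHitting n).toFinset (c k)))
    have h1 := supZero_le_iff.1 (le_refl (F k ν))
    refine le_antisymm (supZero_le_iff.2 ⟨h0.1, fun v _ => ?_⟩)
      (supZero_le_iff.2 ⟨h1.1, fun A hA => ?_⟩)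
    · split_ifs with hpos
      -- Positive mass of the fibre over `v` produces an actual particle at which `c k` equals `v`;
      -- finiteness comes from boundedness of the family.
      · obtain ⟨A, hA, hA0⟩ := exists_mem_measure_singleton_pos ν.integer_valued (hbdd k v).1 hpos
          (ν.finite_on_bounded _ (hbdd k v))
        have hv : c k A = v := hA.1
        rw [← hv]
        exact h0.2 A ((ν.finite_particlesHitting n).mem_toFinset.2 ⟨hA.2, hA0⟩)
      · exact h0.1
    · have hA' := (ν.finite_particlesHitting n).mem_toFinset.1 hA
      have h2 := h1.2 (c k A) (SimpleFunc.mem_range_self (c k) A)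
      have hAs : A ∈ c k ⁻¹' {c k A} ∩ hitting d n := ⟨rfl, hA'.1⟩
      rwa [if_pos (hA'.2.trans_le (measure_mono (singleton_subset_iff.2 hAs)))] at h2
  refine measurable_of_tendsto_metrizable hF (tendsto_pi_nhds.2 fun ν => ?_)
  simp only [hFeq]
  exact tendsto_supZero hc

theorem indicator_one_union {α : Type*} (S T : Set α) (x : α) :
    (S ∪ T).indicator (1 : α → ℝ) x = S.indicator 1 x ⊔ T.indicator 1 x := by
  by_cases h1 : x ∈ S <;> by_cases h2 : x ∈ T <;> simp [h1, h2]

theorem coeFn_supZero_toLpOn {d : ℕ} (K : Set (Space d)) (s : Finset (FP d)) :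
    ⇑(supZero s (FP.toLpOn K)) =ᵐ[volume.restrict K]
      (⋃ A ∈ s, A.rep).indicator 1 := by
  classical
  induction s using Finset.induction_on with
  | empty =>
    rw [supZero_empty]
    filter_upwards [Lp.coeFn_zero ℝ 1 ((volume : Measure (Space d)).restrict K)] with x hx
    exact hx.trans (by simp)
  | insert a s ha ih =>
    rw [supZero_insert ha]
    filter_upwards [Lp.coeFn_sup (a.toLpOn K) (supZero s (FP.toLpOn K)), ih, a.coeFn_toLpOn K,
      ae_restrict_of_ae a.ind_ae_eq_rep] with x h1 h2 h3 h4
    rw [h1, Pi.sup_apply, h2, h3, h4, Finset.set_biUnion_insert, indicator_one_union]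

theorem tendsto_L1_of_ae_eq_indicator {α : Type*} [MeasurableSpace α] {m : Measure α}
    [IsFiniteMeasure m] {u : ℕ → Lp ℝ 1 m} {v : Lp ℝ 1 m} {S : ℕ → Set α} {T : Set α}
    (hu : ∀ n, u n =ᵐ[m] (S n).indicator 1) (hv : v =ᵐ[m] T.indicator 1)
    (h : ∀ x, ∀ᶠ n in Filter.atTop, x ∈ S n ↔ x ∈ T) :
    Filter.Tendsto u Filter.atTop (𝓝 v) := by
  rw [tendsto_iff_norm_sub_tendsto_zero]
  simp only [L1.norm_eq_integral_norm]
  have hd : ∀ n, (u n - v : Lp ℝ 1 m) =ᵐ[m] fun x =>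
      (S n).indicator (1 : α → ℝ) x - T.indicator 1 x := by
    intro n
    filter_upwards [Lp.coeFn_sub (u n) v, hu n, hv] with x h1 h2 h3
    rw [h1, Pi.sub_apply, h2, h3]
  have hlim := tendsto_integral_of_dominated_convergence (μ := m)
    (F := fun n x => ‖(u n - v : Lp ℝ 1 m) x‖) (f := fun _ => (0 : ℝ)) (fun _ => (1 : ℝ))
    (fun n => (L1.integrable_coeFn _).norm.aestronglyMeasurable) (integrable_const _)
    (fun n => ?_) ?_
  · simpa using hlim
  · filter_upwards [hd n] with x hx
    rw [hx, norm_norm]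
    by_cases h1 : x ∈ S n <;> by_cases h2 : x ∈ T <;> simp [h1, h2]
  · filter_upwards [ae_all_iff.2 hd] with x hx
    refine tendsto_const_nhds.congr' ?_
    filter_upwards [h x] with n hn
    rw [hx n]
    by_cases h1 : x ∈ T <;> simp [h1, hn]

/-- At each point membership in the growing finite unions is eventually that of the full union; on a
ball of finite volume dominated convergence gives convergence in `L^1`. -/
theorem Config.tendsto_finiteUnionOn {d : ℕ} (k : ℕ) (ν : Config d) :
    Filter.Tendsto (fun n => ν.finiteUnionOn (compactBall d k : Set (Space d)) n) Filter.atTop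
      (𝓝 (ν.union.toBVloc.restrict (compactBall d k))) := by
  have : IsFiniteMeasure ((volume : Measure (Space d)).restrict (compactBall d k)) :=
    ⟨by simpa using (compactBall d k).isCompact.measure_lt_top⟩
  refine tendsto_L1_of_ae_eq_indicator (fun n => coeFn_supZero_toLpOn _ _)
    ((BVloc.coeFn_restrict _ _).trans (ae_restrict_of_ae ν.union_ind)) fun x => ?_
  by_cases hx : x ∈ ν.unionSet
  · obtain ⟨⟨A, hA⟩, hxA⟩ := mem_iUnion.1 hx
    obtain ⟨n₀, hn₀⟩ := mem_iUnion.1 hA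
    filter_upwards [Filter.eventually_ge_atTop n₀] with n hn
    refine iff_of_true (mem_iUnion₂.2 ⟨A, ?_, hxA⟩) hx
    exact (ν.finite_particlesHitting n).mem_toFinset.2 ⟨hitting_mono hn hn₀.1, hn₀.2⟩
  · refine Filter.Eventually.of_forall fun n => iff_of_false (fun h => hx ?_) hx
    obtain ⟨A, hA, hxA⟩ := mem_iUnion₂.1 h
    exact mem_iUnion.2 ⟨⟨A, mem_iUnion.2 ⟨n, (ν.finite_particlesHitting n).mem_toFinset.1 hA⟩⟩, hxA⟩

theorem Config.measurable_union (d : ℕ) : Measurable (Config.union : Config d → FPloc d) :=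
  FPloc.measurable_of_restrict fun k => measurable_of_tendsto_metrizable
    (fun n => Config.measurable_finiteUnionOn (compactBall d k : Set (Space d)) n)
    (tendsto_pi_nhds.2 fun ν => ν.tendsto_finiteUnionOn k)

end FPProcess

theorem mainTheorem2 {d : ℕ} (hd : 1 ≤ d) {Ω : Type*} [MeasurableSpace Ω] (P : Measure Ω)
    [IsProbabilityMeasure P] (Φ : Ω → FPProcess.Config d) (hΦ : Measurable Φ) :
    ∃ X : Ω → FPProcess.FPloc d,
      (∀ ω, FPProcess.IsUnionOf (X ω) (Φ ω)) ∧ Measurable X ∧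
      (FPProcess.IsStationaryProcess P Φ → FPProcess.IsStationarySet P X) := by
  have hU := FPProcess.Config.measurable_union d
  refine ⟨fun ω => (Φ ω).union, fun ω => (Φ ω).isUnionOf_union hd, hU.comp hΦ, fun hst z => ?_⟩
  -- The law of the translated union is the image under `Config.union` of the law of the shifted
  -- process, so invariance of the latter gives invariance of the former.
  have h1 : P.map (fun ω => (Φ ω).union.translate z) =
      (P.map fun ω => (Φ ω).shift z).map FPProcess.Config.union := by
    have hs : Measurable fun ω => (Φ ω).shift z := (FPProcess.Config.measurable_shift z).comp hΦ
    rw [Measure.map_map hU hs]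
    simp only [← FPProcess.Config.union_shift hd]
    rfl
  rw [h1, hst z, Measure.map_map hU hΦ]
  rfl
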